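/- **Setting.** Let $n,d\ge 1$, let $X\in\mathbb R^{n\times d}$ be a fixed design matrix with rows $x_1',\dots,x_n'$, $\|X\|_\infty=\max_{i,j}|X_{ij}|$, and $\theta_\star\in\mathbb R^d$. Let $Z_1,\dots,Z_n$ be independent $0$-$1$ random variables with $\mathbb P(Z_i=1)=e^{\langle x_i,\theta_\star\rangle}/(1+e^{\langle x_i,\theta_\star\rangle})$, and let $\mathbb E^{(n)}$ denote the expectation. Put $g(x)=\log(1+e^x)$. For $\delta\in\{0,1\}^d$ with $\|\delta\|_0=\sum_j\delta_j$, let $\Pi(\cdot\mid\delta)$ be the law on $\mathbb R^d$ of independent coordinates $\theta_j$, where $\theta_j=0$ if $\delta_j=0$ and $\theta_j$ has density $\frac{\rho}{2}e^{-\rho|x|}$ if $\delta_j=1$; here $\rho=4\|X\|_\infty\sqrt{n\log d}$. The prior is $\Pi=\sum_\delta\pi_\delta\Pi(\cdot\mid\delta)$ and the posterior is $$\check\Pi_{n,d}(B\mid Z)=\frac{\int_B q_\theta(Z)\,\Pi(d\theta)}{\int_{\mathbb R^d}q_\theta(Z)\,\Pi(d\theta)},\qquad q_\theta(z)=\exp\Big(\sum_{i=1}^n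 \big(z_i\langle x_i,\theta\rangle-g(\langle x_i,\theta\rangle)\big)\Big).$$ The prior weights satisfy, with constants $c_1,c_2>0$ and $c_3\ge c_4>0$, $$\pi_\delta=g_{\|\delta\|_0}\binom{d}{\|\delta\|_0}^{-1},\qquad \frac{c_1}{d^{c_3}}g_{s-1}\le g_s\le\frac{c_2}{d^{c_4}}g_{s-1}\quad(1\le s\le d)\qquad\text{(H2)}$$ for a probability distribution $(g_s)_{0\le s\le d}$ on $\{0,\dots,d\}$. Let $\|\theta\|_0$ be the number of non-zero coordinates of $\theta$, $s_\star=\|\theta_\star\|_0$, $S_\star=\{j:\theta_{\star j}\ne0\}$, and $W=\mathrm{diag}\big(g''(\langle x_i,\theta_\star\rangle)\big)_{1\le i\le n}$. Define $$\underline\kappa_1=\inf\Big\{\tfrac{\theta'(X'WX)\theta}{n\|\theta\|_2^2}:\theta\ne0,\ \sum_{j\notin S_\star}|\theta_j|\le7\sum_{j\in S_\star}|\theta_j|\Big\}\qquad(\inf\emptyset=+\infty),$$ $$\underline\kappa_1(s)=\inf\Big\{\tfrac{\theta'(X'WX)\theta}{n\|\theta\|_2^2}:1\le\|\theta\|_0\le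 s\Big\},\qquad \bar\kappa_1(s)=\sup\Big\{\tfrac{\theta'(X'X)\theta}{n\|\theta\|_2^2}:1\le\|\theta\|_0\le s\Big\},$$ $$\zeta=s_\star+\frac2{c_4}+\frac2{c_4}\Big(1+\frac{64\|X\|_\infty^2}{\underline\kappa_1}+\frac{\bar\kappa_1(s_\star)}{64\|X\|_\infty^2(\log d)^2}+\frac{\log(4e)}{\log d}\Big)s_\star$$ (the last term being $0$ when $s_\star=0$), $\bar s=\lceil s_\star+\zeta\rceil$ and $\underline\kappa=\min(\underline\kappa_1,\underline\kappa_1(\bar s))$. **Theorem.** There is a universal constant $A\in(0,\infty)$ such that for all $c_1,c_2>0$ and $c_3\ge c_4>0$ there are a finite constant $M_0>2$ and an integer $d_0$, both depending only on $(c_1,c_2,c_3,c_4)$, such that in the setting above (in particular under (H2)), whenever $d\ge d_0$, $\underline\kappa>0$ and $$n\ \ge\ A\,\|X\|_\infty^4\Big(\frac{s_\star}{\underline\kappa}\Big)^2\log d,$$ one has 1. $\displaystyle \mathbb E^{(n)}\big[\check\Pi_{n,d}\big(\{\theta\in\mathbb R^d:\|\theta\|_0\ge\zeta\}\mid Z\big)\big]\le\frac4d$;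 2. $\displaystyle \mathbb E^{(n)}\Big[\check\Pi_{n,d}\Big(\Big\{\theta\in\mathbb R^d:\|\theta-\theta_\star\|_2>\frac{M_0\|X\|_\infty}{\underline\kappa_1(\bar s)}\sqrt{\frac{\bar s\log d}{n}}\Big\}\,\Big|\,Z\Big)\Big]\le\frac{12}d$. -/

import Mathlib

open MeasureTheory ProbabilityTheory
open scoped ENNReal

noncomputable section

namespace SparseLogit

/-- The set of non-zero coordinates of `θ`. Elements `δ` of `{0,1}^d` are represented throughout by
the finite set `{j | δ_j = 1}`, so this is the sparsity structure of `θ`. -/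
def supp {d : ℕ} (θ : Fin d → ℝ) : Finset (Fin d) :=
  Finset.univ.filter fun j => 0 < |θ j|

/-- `‖θ‖₀`, the number of non-zero coordinates. -/
def l0norm {d : ℕ} (θ : Fin d → ℝ) : ℕ := (supp θ).card

/-- The Euclidean norm `‖θ‖₂`. -/
def l2norm {d : ℕ} (θ : Fin d → ℝ) : ℝ := ‖(WithLp.toLp 2 θ : EuclideanSpace ℝ (Fin d))‖

/-- `‖X‖_∞ = max_{i,j} |X_{ij}|`. -/
def maxNorm {n d : ℕ} (X : Matrix (Fin n) (Fin d) ℝ) : ℝ :=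
  ⨆ p : Fin n × Fin d, |X p.1 p.2|

/-- `g(x) = log(1 + e^x)`. -/
def g (x : ℝ) : ℝ := Real.log (1 + Real.exp x)

/-- The logistic likelihood `q_{n,θ}(z) = exp(∑ i, (z_i ⟨x_i, θ⟩ - g(⟨x_i, θ⟩)))`, where `x_i` is the
`i`-th row of `X`. -/
def likelihood {n d : ℕ} (X : Matrix (Fin n) (Fin d) ℝ) (θ : Fin d → ℝ) (z : Fin n → ℝ) : ℝ :=
  Real.exp (∑ i, (z i * (X i ⬝ᵥ θ) - g (X i ⬝ᵥ θ)))

/-- The Laplace distribution with parameter `ρ`: density `(ρ/2) e^{-ρ|x|}`. -/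
def laplace (ρ : ℝ) : Measure ℝ :=
  volume.withDensity fun x => ENNReal.ofReal (ρ / 2 * Real.exp (-ρ * |x|))

/-- The spike-and-slab conditional prior `Π(dθ | δ)`: independent coordinates, Laplace on `δ`, and a
Dirac mass at `0` off `δ`. -/
def condPrior {d : ℕ} (ρ : ℝ) (δ : Finset (Fin d)) : Measure (Fin d → ℝ) :=
  Measure.pi fun j => if j ∈ δ then laplace ρ else Measure.dirac 0

/-- The prior `Π = ∑_δ π_δ Π(· | δ)`. -/
def prior {d : ℕ} (ρ : ℝ) (w : Finset (Fin d) → ℝ) : Measure (Fin d → ℝ) :=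
  ∑ δ : Finset (Fin d), ENNReal.ofReal (w δ) • condPrior ρ δ

/-- The posterior distribution given data `z`: the prior reweighted by the likelihood and
normalized. -/
def posterior {n d : ℕ} (X : Matrix (Fin n) (Fin d) ℝ) (ρ : ℝ) (w : Finset (Fin d) → ℝ)
    (z : Fin n → ℝ) : Measure (Fin d → ℝ) :=
  (∫⁻ θ, ENNReal.ofReal (likelihood X θ z) ∂(prior ρ w))⁻¹ •
    (prior ρ w).withDensity fun θ => ENNReal.ofReal (likelihood X θ z)

/-- The prior weights are `π_δ = h_{|δ|} / binom(d, |δ|)` for a probability distribution `h` on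
`{0, …, d}` with `(c₁ / d^{c₃}) h_{s-1} ≤ h_s ≤ (c₂ / d^{c₄}) h_{s-1}` for `s = 1, …, d`. -/
def SparsePrior (d : ℕ) (c₁ c₂ c₃ c₄ : ℝ) (w : Finset (Fin d) → ℝ) : Prop :=
  ∃ h : ℕ → ℝ,
    (∀ s ≤ d, 0 ≤ h s) ∧ (∑ s ∈ Finset.range (d + 1), h s = 1) ∧
    (∀ s, 1 ≤ s → s ≤ d →
      c₁ / (d : ℝ) ^ c₃ * h (s - 1) ≤ h s ∧ h s ≤ c₂ / (d : ℝ) ^ c₄ * h (s - 1)) ∧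
    ∀ δ : Finset (Fin d), w δ = h δ.card / (d.choose δ.card : ℝ)

/-- `Z_1, …, Z_n` are independent `0`-`1` random variables which follow the logistic regression model
with design matrix `X` and parameter `θs`. -/
structure LogisticModel {Ω : Type*} [MeasurableSpace Ω] (P : Measure Ω) {n d : ℕ}
    (X : Matrix (Fin n) (Fin d) ℝ) (θs : Fin d → ℝ) (Z : Fin n → Ω → ℝ) : Prop where
  measurable : ∀ i, Measurable (Z i)
  binary : ∀ i ω, Z i ω = 0 ∨ Z i ω = 1
  indep : iIndepFun Z P
  prob_one : ∀ i, P {ω | Z i ω = 1} =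
    ENNReal.ofReal (Real.exp (X i ⬝ᵥ θs) / (1 + Real.exp (X i ⬝ᵥ θs)))

/-- The diagonal matrix `W` with entries `g''(⟨x_i, θs⟩)`. -/
def weight {n d : ℕ} (X : Matrix (Fin n) (Fin d) ℝ) (θs : Fin d → ℝ) : Matrix (Fin n) (Fin n) ℝ :=
  Matrix.diagonal fun i => deriv (deriv g) (X i ⬝ᵥ θs)

/-- The quotient `θ' M θ / (n ‖θ‖₂²)`. -/
def quotient {d : ℕ} (n : ℕ) (M : Matrix (Fin d) (Fin d) ℝ) (θ : Fin d → ℝ) : ℝ :=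
  (θ ⬝ᵥ M.mulVec θ) / (n * l2norm θ ^ 2)

/-- `κ₁`, the infimum of `θ'(X'WX)θ / (n‖θ‖₂²)` over `θ ≠ 0` with
`‖θ·δ⋆ᶜ‖₁ ≤ 7 ‖θ·δ⋆‖₁`. It takes values in the extended reals because there is no such `θ` when
`θs = 0`; the infimum is then `+∞`. -/
def kappa {n d : ℕ} (X : Matrix (Fin n) (Fin d) ℝ) (θs : Fin d → ℝ) : EReal :=
  ⨅ θ ∈ {θ : Fin d → ℝ | θ ≠ 0 ∧ ∑ j ∈ (supp θs)ᶜ, |θ j| ≤ 7 * ∑ j ∈ supp θs, |θ j|},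
    ((quotient n (X.transpose * weight X θs * X) θ : ℝ) : EReal)

/-- `κ₁(s)`, the infimum of `θ'(X'WX)θ / (n‖θ‖₂²)` over `1 ≤ ‖θ‖₀ ≤ s`. -/
def kappaSparse {n d : ℕ} (X : Matrix (Fin n) (Fin d) ℝ) (θs : Fin d → ℝ) (s : ℕ) : ℝ :=
  sInf (quotient n (X.transpose * weight X θs * X) '' {θ | 1 ≤ l0norm θ ∧ l0norm θ ≤ s})

/-- `κ̄₁(s)`, the supremum of `θ'(X'X)θ / (n‖θ‖₂²)` over `1 ≤ ‖θ‖₀ ≤ s`. -/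
def kappaBar {n d : ℕ} (X : Matrix (Fin n) (Fin d) ℝ) (s : ℕ) : ℝ :=
  sSup (quotient n (X.transpose * X) '' {θ | 1 ≤ l0norm θ ∧ l0norm θ ≤ s})

/-- `ρ = 4 ‖X‖_∞ √(n log d)`. -/
def rho {n d : ℕ} (X : Matrix (Fin n) (Fin d) ℝ) : ℝ :=
  4 * maxNorm X * √(n * Real.log d)

/-- The sparsity level `ζ`. When `θs = 0` (so that `kappa` is `+∞`), the bracket is multiplied by
`s⋆ = 0`. -/
def zeta {n d : ℕ} (c₄ : ℝ) (X : Matrix (Fin n) (Fin d) ℝ) (θs : Fin d → ℝ) : ℝ :=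
  l0norm θs + 2 / c₄ + 2 / c₄ *
    (1 + 64 * maxNorm X ^ 2 / (kappa X θs).toReal
      + kappaBar X (l0norm θs) / (64 * maxNorm X ^ 2 * Real.log d ^ 2)
      + Real.log (4 * Real.exp 1) / Real.log d) * l0norm θs

/-- `s̄ = ⌈s⋆ + ζ⌉`. -/
def sBar {n d : ℕ} (c₄ : ℝ) (X : Matrix (Fin n) (Fin d) ℝ) (θs : Fin d → ℝ) : ℕ :=
  ⌈(l0norm θs : ℝ) + zeta c₄ X θs⌉₊

/-- `κ = min(κ₁, κ₁(s̄))`. -/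
def kappaMin {n d : ℕ} (c₄ : ℝ) (X : Matrix (Fin n) (Fin d) ℝ) (θs : Fin d → ℝ) : EReal :=
  min (kappa X θs) ((kappaSparse X θs (sBar c₄ X θs) : ℝ) : EReal)

end SparseLogit

end

/-!
A Taylor expansion of the log-likelihood at `θs` splits the log-likelihood ratio of `θ` against `θs`
into the score and a remainder. As `g` is self-concordant, the remainder is at least
`u'(X'WX)u / (2 + k)` for `u = θ - θs`, where `k` is proportional to `‖X‖_∞ ‖u‖₁`.

By Hoeffding's inequality all scores are at most `ρ / 2`, except on an event of probability `2 / d`.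
There the `ℓ₁` penalty dominates the score outside of the cone of `κ₁`, and the curvature dominates
it in the cone, so the penalized likelihood ratio is `O(s⋆ log d) - ρ‖u‖₁ / 4` in the exponent.
Since the Laplace prior has the shape of the penalty, the numerator of the posterior reduces to a
sum over model sizes, and Jensen's inequality for the prior shifted by `θs` bounds the denominator
from below. The geometric decay of the law of the model size then rules out large models. For `θ` of
moderate size, the restricted eigenvalue `κ₁(s̄)` or, when `‖u‖₁` is large, the penalty makes the
exponent at most `-K (1 + s⋆) log d` away from `θs`, which exceeds the prior cost of the support of
`θs`.
-/

namespace SparseLogit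

open Real

section Logistic

lemma hasDerivAt_g (x : ℝ) : HasDerivAt g (sigmoid x) x := by
  have h : HasDerivAt (fun y => 1 + exp y) (exp x) x := (hasDerivAt_exp x).const_add 1
  have hσ : sigmoid x = exp x / (1 + exp x) := by
    rw [sigmoid_def, exp_neg]
    field_simp
    ring
  exact hσ ▸ h.log (by positivity)

lemma deriv_deriv_g (x : ℝ) : deriv (deriv g) x = sigmoid x * (1 - sigmoid x) := by
  have : deriv g = sigmoid := funext fun y => (hasDerivAt_g y).deriv
  rw [this, deriv_sigmoid]

lemma continuous_g : Continuous g :=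
  continuous_iff_continuousAt.2 fun x => (hasDerivAt_g x).continuousAt

lemma g_neg (x : ℝ) : g (-x) = g x - x := by
  have : 1 + exp (-x) = (1 + exp x) / exp x := by
    rw [exp_neg]
    field_simp
    ring
  rw [g, g, this, log_div (by positivity) (by positivity), log_exp]

lemma sigmoid_mul_one_sub_nonneg (t : ℝ) : 0 ≤ sigmoid t * (1 - sigmoid t) :=
  mul_nonneg (sigmoid_nonneg t) (sub_nonneg.2 (sigmoid_le_one t))

lemma sigmoid_mul_one_sub_le (t : ℝ) : sigmoid t * (1 - sigmoid t) ≤ 1 / 4 := by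
  nlinarith [sq_nonneg (sigmoid t - 1 / 2)]

lemma sigmoid_add_sub (t y : ℝ) :
    sigmoid (t + y) - sigmoid t = sigmoid (t + y) * (1 - sigmoid t) * (1 - exp (-y)) := by
  rw [sigmoid_def, sigmoid_def, neg_add, exp_add]
  field_simp
  ring

lemma le_of_hasDerivAt_le {f f' k k' : ℝ → ℝ} (hf : ∀ x, HasDerivAt f (f' x) x)
    (hk : ∀ x, HasDerivAt k (k' x) x) (h0 : f 0 ≤ k 0) (hle : ∀ x, 0 ≤ x → f' x ≤ k' x)
    {x : ℝ} (hx : 0 ≤ x) : f x ≤ k x :=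
  image_le_of_deriv_right_le_deriv_boundary
    (fun y _ => (hf y).continuousAt.continuousWithinAt) (fun y _ => (hf y).hasDerivWithinAt) h0
    (fun y _ => (hk y).continuousAt.continuousWithinAt) (fun y _ => (hk y).hasDerivWithinAt)
    (fun y hy => hle y hy.1) (Set.right_mem_Icc.2 hx)

lemma sigmoid_add_sub_le (t : ℝ) {y : ℝ} (hy : 0 ≤ y) : sigmoid (t + y) - sigmoid t ≤ y / 4 :=
  le_of_hasDerivAt_le
    (fun x => ((hasDerivAt_sigmoid (t + x)).comp_const_add t x).sub_const (sigmoid t))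
    (fun x => (hasDerivAt_id x).div_const 4) (by simp)
    (fun x _ => sigmoid_mul_one_sub_le (t + x)) hy

lemma le_sigmoid_add_sub (t : ℝ) {y : ℝ} (hy : 0 ≤ y) :
    sigmoid t * (1 - sigmoid t) * (1 - exp (-y)) ≤ sigmoid (t + y) - sigmoid t := by
  rw [sigmoid_add_sub]
  have h₁ : 0 ≤ 1 - sigmoid t := sub_nonneg.2 (sigmoid_le_one t)
  have h₂ : 0 ≤ 1 - exp (-y) := sub_nonneg.2 (exp_le_one_iff.2 (neg_nonpos.2 hy))
  gcongr
  exact le_add_of_nonneg_right hy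

lemma hasDerivAt_exp_neg (x : ℝ) : HasDerivAt (fun y => exp (-y)) (-exp (-x)) x := by
  simpa using (hasDerivAt_neg x).exp

lemma sq_div_two_add_le {x : ℝ} (hx : 0 ≤ x) : x ^ 2 / (2 + x) ≤ exp (-x) + x - 1 := by
  have hderiv (y : ℝ) : HasDerivAt (fun y => (2 + y) * exp (-y) + y)
      (1 * exp (-y) + (2 + y) * (-exp (-y)) + 1) y :=
    (((hasDerivAt_id y).const_add 2).mul (hasDerivAt_exp_neg y)).add (hasDerivAt_id y)
  have hpade : 2 ≤ (2 + x) * exp (-x) + x := by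
    refine le_of_hasDerivAt_le (fun y => hasDerivAt_const y 2) hderiv (by simp) (fun y _ => ?_) hx
    have : (y + 1) * exp (-y) ≤ exp y * exp (-y) := by gcongr; exact add_one_le_exp y
    rw [← exp_add, add_neg_cancel, exp_zero] at this
    linarith
  rw [div_le_iff₀ (by linarith)]
  linarith

/-- The remainder `g (t + h) - g t - g' t * h` of the first order Taylor expansion of `g` at `t`. It
is the contribution of one observation to the negative log-likelihood beyond its linear part. -/
noncomputable def bregman (t h : ℝ) : ℝ := g (t + h) - g t - sigmoid t * h

lemma continuous_bregman (t : ℝ) : Continuous (bregman t) := by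
  have := continuous_g
  unfold bregman
  fun_prop

lemma bregman_neg (t h : ℝ) : bregman (-t) (-h) = bregman t h := by
  rw [bregman, bregman, ← neg_add, g_neg, g_neg, sigmoid_neg]
  ring

lemma hasDerivAt_bregman (t h : ℝ) : HasDerivAt (bregman t) (sigmoid (t + h) - sigmoid t) h := by
  have hg : HasDerivAt (fun y => g (t + y)) (sigmoid (t + h)) h :=
    (hasDerivAt_g (t + h)).comp_const_add t h
  have hlin : HasDerivAt (fun y => sigmoid t * y) (sigmoid t) h := by
    simpa using (hasDerivAt_id h).const_mul (sigmoid t)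
  exact (hg.sub_const (g t)).sub hlin

lemma le_bregman_of_nonneg (t : ℝ) {h : ℝ} (hh : 0 ≤ h) :
    sigmoid t * (1 - sigmoid t) * (h ^ 2 / (2 + h)) ≤ bregman t h := by
  have hderiv (y : ℝ) : HasDerivAt (fun y => sigmoid t * (1 - sigmoid t) * (exp (-y) + y - 1))
      (sigmoid t * (1 - sigmoid t) * (-exp (-y) + 1)) y :=
    (((hasDerivAt_exp_neg y).add (hasDerivAt_id y)).sub_const 1).const_mul _
  refine (mul_le_mul_of_nonneg_left (sq_div_two_add_le hh) (sigmoid_mul_one_sub_nonneg t)).trans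
    (le_of_hasDerivAt_le hderiv (hasDerivAt_bregman t) (by simp [bregman]) (fun y hy => ?_) hh)
  rw [neg_add_eq_sub]
  exact le_sigmoid_add_sub t hy

lemma bregman_le_of_nonneg (t : ℝ) {h : ℝ} (hh : 0 ≤ h) : bregman t h ≤ h ^ 2 / 8 := by
  have hderiv (y : ℝ) : HasDerivAt (fun y : ℝ => y ^ 2 / 8) (y / 4) y := by
    refine ((hasDerivAt_pow 2 y).div_const 8).congr_deriv ?_
    norm_num
    ring
  exact le_of_hasDerivAt_le (hasDerivAt_bregman t) hderiv (by simp [bregman])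
    (fun y hy => sigmoid_add_sub_le t hy) hh

lemma le_bregman (t h : ℝ) :
    sigmoid t * (1 - sigmoid t) * (h ^ 2 / (2 + |h|)) ≤ bregman t h := by
  rcases le_total 0 h with hh | hh
  · simpa only [abs_of_nonneg hh] using le_bregman_of_nonneg t hh
  · have := le_bregman_of_nonneg (-t) (neg_nonneg.2 hh)
    rw [bregman_neg, sigmoid_neg] at this
    rw [abs_of_nonpos hh]
    convert this using 1
    ring

lemma bregman_le (t h : ℝ) : bregman t h ≤ h ^ 2 / 8 := by
  rcases le_total 0 h with hh | hh
  · exact bregman_le_of_nonneg t hh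
  · simpa only [bregman_neg, neg_sq] using bregman_le_of_nonneg (-t) (neg_nonneg.2 hh)

lemma bregman_nonneg (t h : ℝ) : 0 ≤ bregman t h :=
  (mul_nonneg (sigmoid_mul_one_sub_nonneg t) (by positivity)).trans (le_bregman t h)

end Logistic

section Measure

lemma ofReal_exp_integral_le_lintegral {α : Type*} [MeasurableSpace α] {μ : Measure α}
    [IsProbabilityMeasure μ] {f : α → ℝ} (hf : Integrable f μ) :
    ENNReal.ofReal (exp (∫ x, f x ∂μ)) ≤ ∫⁻ x, ENNReal.ofReal (exp (f x)) ∂μ := by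
  by_cases hexp : Integrable (fun x => exp (f x)) μ
  · rw [← ofReal_integral_eq_lintegral_ofReal hexp (ae_of_all _ fun x => (exp_pos _).le)]
    exact ENNReal.ofReal_le_ofReal (convexOn_exp.map_integral_le continuous_exp.continuousOn
      isClosed_univ (ae_of_all _ fun x => Set.mem_univ (f x)) hf hexp)
  · have hmeas : AEStronglyMeasurable (fun x => exp (f x)) μ :=
      continuous_exp.comp_aestronglyMeasurable hf.aestronglyMeasurable
    have htop : ∫⁻ x, ENNReal.ofReal (exp (f x)) ∂μ = ⊤ := by
      by_contra h
      exact hexp ((lintegral_ofReal_ne_top_iff_integrable hmeas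
        (ae_of_all _ fun x => (exp_pos _).le)).1 h)
    exact htop ▸ le_top

lemma lintegral_le_add_measure {α : Type*} [MeasurableSpace α] {μ : Measure α}
    [IsProbabilityMeasure μ] {f : α → ℝ≥0∞} {E : Set α} {x : ℝ≥0∞} (hE : MeasurableSet E)
    (hf1 : ∀ a, f a ≤ 1) (hf : ∀ a, a ∉ E → f a ≤ x) : ∫⁻ a, f a ∂μ ≤ x + μ E := by
  calc ∫⁻ a, f a ∂μ ≤ ∫⁻ a, (x + E.indicator 1 a) ∂μ := by
        refine lintegral_mono fun a => ?_
        by_cases ha : a ∈ E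
        · rw [Set.indicator_of_mem ha]
          exact (hf1 a).trans le_add_self
        · exact (hf a ha).trans le_self_add
    _ = x + μ E := by
        rw [lintegral_add_left measurable_const, lintegral_const, measure_univ, mul_one,
          lintegral_indicator_one hE]

variable {ι : Type*} [Fintype ι] {α : ι → Type*} [∀ i, MeasurableSpace (α i)]
  {μ : ∀ i, Measure (α i)} [∀ i, IsProbabilityMeasure (μ i)]

lemma lintegral_pi_prod {f : ∀ i, α i → ℝ≥0∞} (hf : ∀ i, Measurable (f i)) :
    ∫⁻ x, ∏ i, f i (x i) ∂Measure.pi μ = ∏ i, ∫⁻ y, f i y ∂μ i := by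
  rw [lintegral_prod_eq_prod_lintegral_of_indepFun Finset.univ (fun i (x : ∀ i, α i) => f i (x i))
    (iIndepFun_pi fun i => (hf i).aemeasurable) fun i => (hf i).comp (measurable_pi_apply i)]
  exact Finset.prod_congr rfl fun i _ => (measurePreserving_eval μ i).lintegral_comp (hf i)

lemma pi_withDensity {f : ∀ i, α i → ℝ≥0∞} (hf : ∀ i, Measurable (f i))
    [∀ i, SigmaFinite ((μ i).withDensity (f i))] :
    Measure.pi (fun i => (μ i).withDensity (f i)) =
      (Measure.pi μ).withDensity fun x => ∏ i, f i (x i) := by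
  refine Measure.pi_eq fun s hs => ?_
  have hprod : (Set.univ.pi s).indicator (fun x : ∀ i, α i => ∏ i, f i (x i)) =
      fun x => ∏ i, (s i).indicator (f i) (x i) := by
    funext x
    by_cases hx : x ∈ Set.univ.pi s
    · rw [Set.indicator_of_mem hx]
      exact Finset.prod_congr rfl fun i _ => (Set.indicator_of_mem (hx i trivial) _).symm
    · rw [Set.indicator_of_notMem hx]
      simp only [Set.mem_pi, Set.mem_univ, true_imp_iff, not_forall] at hx
      obtain ⟨i, hi⟩ := hx
      exact (Finset.prod_eq_zero (Finset.mem_univ i) (Set.indicator_of_notMem hi _)).symm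
  rw [withDensity_apply _ (.univ_pi hs), ← lintegral_indicator (.univ_pi hs), hprod,
    lintegral_pi_prod fun i => (hf i).indicator (hs i)]
  refine Finset.prod_congr rfl fun i _ => ?_
  rw [withDensity_apply _ (hs i), lintegral_indicator (hs i)]

end Measure

section Laplace

variable {ρ : ℝ}

lemma integral_exp_neg_mul_abs {b : ℝ} (hb : 0 < b) : ∫ x : ℝ, exp (-b * |x|) = 2 / b := by
  rw [integral_comp_abs (f := fun x => exp (-b * x)), integral_exp_mul_Ioi (by linarith),
    mul_zero, exp_zero]
  ring

lemma lintegral_exp_neg_mul_abs_sub {b : ℝ} (hb : 0 < b) (t : ℝ) :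
    ∫⁻ x, ENNReal.ofReal (exp (-b * |x - t|)) = ENNReal.ofReal (2 / b) := by
  have hint : Integrable fun x : ℝ => exp (-b * |x|) :=
    .of_integral_ne_zero (integral_exp_neg_mul_abs hb ▸ by positivity)
  rw [lintegral_sub_right_eq_self (fun x => ENNReal.ofReal (exp (-b * |x|))) t,
    ← ofReal_integral_eq_lintegral_ofReal hint (ae_of_all _ fun x => (exp_pos _).le),
    integral_exp_neg_mul_abs hb]

lemma lintegral_laplace {f : ℝ → ℝ≥0∞} (hf : Measurable f) :
    ∫⁻ x, f x ∂laplace ρ = ∫⁻ x, ENNReal.ofReal (ρ / 2 * exp (-ρ * |x|)) * f x :=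
  lintegral_withDensity_eq_lintegral_mul _ (by fun_prop) hf

lemma integral_laplace (hρ : 0 < ρ) (f : ℝ → ℝ) :
    ∫ x, f x ∂laplace ρ = ∫ x, ρ / 2 * exp (-ρ * |x|) * f x := by
  rw [laplace, integral_withDensity_eq_integral_toReal_smul (by fun_prop)
    (ae_of_all _ fun x => ENNReal.ofReal_lt_top)]
  refine integral_congr_ae (ae_of_all _ fun x => ?_)
  simp only [smul_eq_mul]
  rw [ENNReal.toReal_ofReal (by positivity)]

lemma lintegral_laplace_exp (hρ : 0 < ρ) {a : ℝ} (ha : 0 < a) (t : ℝ) :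
    ∫⁻ x, ENNReal.ofReal (exp (ρ * |x| - a * ρ * |x - t|)) ∂laplace ρ = ENNReal.ofReal a⁻¹ := by
  have hdensity (x : ℝ) : ENNReal.ofReal (ρ / 2 * exp (-ρ * |x|)) *
      ENNReal.ofReal (exp (ρ * |x| - a * ρ * |x - t|)) =
      ENNReal.ofReal (ρ / 2) * ENNReal.ofReal (exp (-(a * ρ) * |x - t|)) := by
    rw [← ENNReal.ofReal_mul (by positivity), ← ENNReal.ofReal_mul (by positivity), mul_assoc,
      ← exp_add]
    ring_nf
  rw [lintegral_laplace (by fun_prop)]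
  simp_rw [hdensity]
  rw [lintegral_const_mul _ (by fun_prop), lintegral_exp_neg_mul_abs_sub (by positivity),
    ← ENNReal.ofReal_mul (by positivity)]
  congr 1
  field_simp

lemma isProbabilityMeasure_laplace (hρ : 0 < ρ) : IsProbabilityMeasure (laplace ρ) :=
  ⟨by simpa using lintegral_laplace_exp hρ one_pos 0⟩

lemma integral_laplace_id (hρ : 0 < ρ) : ∫ x, x ∂laplace ρ = 0 := by
  rw [integral_laplace hρ]
  have hodd := integral_neg_eq_self (fun x => ρ / 2 * exp (-ρ * |x|) * x) volume
  simp only [abs_neg, mul_neg, integral_neg] at hodd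
  linarith

lemma integral_laplace_sq (hρ : 0 < ρ) : ∫ x, x ^ 2 ∂laplace ρ = 2 / ρ ^ 2 := by
  have hgamma : ∫ x in Set.Ioi (0 : ℝ), x ^ 2 * exp (-(ρ * x)) = 2 / ρ ^ 3 := by
    calc ∫ x in Set.Ioi (0 : ℝ), x ^ 2 * exp (-(ρ * x)) = (1 / ρ) ^ (3 : ℝ) * Gamma 3 := by
          rw [← integral_rpow_mul_exp_neg_mul_Ioi (by norm_num) hρ]
          norm_num
      _ = 2 / ρ ^ 3 := by
          norm_num
          ring
  calc ∫ x, x ^ 2 ∂laplace ρ = ∫ x, ρ / 2 * (|x| ^ 2 * exp (-(ρ * |x|))) := by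
        rw [integral_laplace hρ]
        refine integral_congr_ae (ae_of_all _ fun x => ?_)
        simp only [sq_abs, neg_mul]
        ring
    _ = ρ / 2 * (2 * (2 / ρ ^ 3)) := by
        rw [integral_const_mul, integral_comp_abs (f := fun x => x ^ 2 * exp (-(ρ * x))), hgamma]
    _ = 2 / ρ ^ 2 := by field_simp

lemma integrable_laplace_sq (hρ : 0 < ρ) : Integrable (fun x : ℝ => x ^ 2) (laplace ρ) :=
  .of_integral_ne_zero (integral_laplace_sq hρ ▸ by positivity)

lemma laplace_eq_map_add_withDensity (t : ℝ) :
    laplace ρ = ((laplace ρ).map fun x => x + t).withDensity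
      fun x => ENNReal.ofReal (exp (ρ * |x - t| - ρ * |x|)) := by
  ext s hs
  have hmeas : Measurable (s.indicator fun x => ENNReal.ofReal (exp (ρ * |x - t| - ρ * |x|))) :=
    Measurable.indicator (by fun_prop) hs
  have hshift : Measurable fun x =>
      s.indicator (fun x => ENNReal.ofReal (exp (ρ * |x - t| - ρ * |x|))) (x + t) :=
    hmeas.comp (measurable_add_const t)
  rw [withDensity_apply _ hs, ← lintegral_indicator hs, lintegral_map hmeas (by fun_prop),
    lintegral_laplace hshift, ← lintegral_indicator_one hs,
    lintegral_laplace (measurable_one.indicator hs), ← lintegral_add_right_eq_self _ t]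
  refine lintegral_congr fun x => ?_
  by_cases hx : x + t ∈ s
  · simp only [Set.indicator_of_mem hx, Pi.one_apply, mul_one, add_sub_cancel_right]
    rw [← ENNReal.ofReal_mul' (exp_pos _).le, mul_assoc, ← exp_add]
    ring_nf
  · simp only [Set.indicator_of_notMem hx, mul_zero]

end Laplace

section Norms

variable {d : ℕ}

lemma mem_supp {θ : Fin d → ℝ} {j : Fin d} : j ∈ supp θ ↔ θ j ≠ 0 := by
  simp [supp]

lemma eq_zero_of_notMem_supp {θ : Fin d → ℝ} {j : Fin d} (hj : j ∉ supp θ) : θ j = 0 :=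
  not_not.1 (mt mem_supp.2 hj)

/-- The norm `‖θ‖₁`. -/
def l1norm (θ : Fin d → ℝ) : ℝ := ∑ j, |θ j|

lemma l1norm_nonneg (θ : Fin d → ℝ) : 0 ≤ l1norm θ := Finset.sum_nonneg fun _ _ => abs_nonneg _

lemma l1norm_add_le (θ θ' : Fin d → ℝ) : l1norm (θ + θ') ≤ l1norm θ + l1norm θ' := by
  rw [l1norm, l1norm, l1norm, ← Finset.sum_add_distrib]
  exact Finset.sum_le_sum fun j _ => abs_add_le (θ j) (θ' j)

end Norms

section CondPrior

variable {d : ℕ} {ρ : ℝ} {δ : Finset (Fin d)}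

/-- The law of the `j`-th coordinate under the conditional prior `condPrior ρ δ`. -/
noncomputable def spikeSlab (ρ : ℝ) (δ : Finset (Fin d)) (j : Fin d) : Measure ℝ :=
  if j ∈ δ then laplace ρ else Measure.dirac 0

lemma condPrior_eq_pi : condPrior ρ δ = Measure.pi (spikeSlab ρ δ) := rfl

lemma isProbabilityMeasure_spikeSlab (hρ : 0 < ρ) (j : Fin d) :
    IsProbabilityMeasure (spikeSlab ρ δ j) := by
  have := isProbabilityMeasure_laplace hρ
  unfold spikeSlab
  split_ifs <;> infer_instance

lemma isProbabilityMeasure_condPrior (hρ : 0 < ρ) : IsProbabilityMeasure (condPrior ρ δ) := by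
  have := isProbabilityMeasure_spikeSlab (δ := δ) hρ
  rw [condPrior_eq_pi]
  infer_instance

lemma ae_supp_subset (hρ : 0 < ρ) : ∀ᵐ θ ∂condPrior ρ δ, supp θ ⊆ δ := by
  have := isProbabilityMeasure_spikeSlab (δ := δ) hρ
  have hzero : ∀ᵐ θ ∂condPrior ρ δ, ∀ j, j ∉ δ → θ j = 0 := by
    refine ae_all_iff.2 fun j => ?_
    by_cases hj : j ∈ δ
    · simp [hj]
    · have hspike : ∀ᵐ x ∂spikeSlab ρ δ j, x = 0 := by
        simp only [spikeSlab, hj, if_false]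
        exact (ae_dirac_iff (measurableSet_singleton (0 : ℝ))).2 rfl
      filter_upwards [(measurePreserving_eval (spikeSlab ρ δ) j).quasiMeasurePreserving.ae hspike]
        with θ hθ _ using hθ
  filter_upwards [hzero] with θ hθ j hj
  exact not_imp_comm.1 (hθ j) (mem_supp.1 hj)

lemma lintegral_spikeSlab_exp_le (hρ : 0 < ρ) {a : ℝ} (ha : 0 < a) (j : Fin d) (t : ℝ) :
    ∫⁻ x, ENNReal.ofReal (exp (ρ * |x| - a * ρ * |x - t|)) ∂spikeSlab ρ δ j ≤
      if j ∈ δ then ENNReal.ofReal a⁻¹ else 1 := by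
  unfold spikeSlab
  split_ifs
  · rw [lintegral_laplace_exp hρ ha]
  · rw [lintegral_dirac' _ (by fun_prop), ENNReal.ofReal_le_one, exp_le_one_iff, abs_zero,
      mul_zero, zero_sub, neg_nonpos]
    positivity

lemma lintegral_condPrior_exp_le (hρ : 0 < ρ) {a : ℝ} (ha : 0 < a) (t : Fin d → ℝ) :
    ∫⁻ θ, ENNReal.ofReal (exp (ρ * l1norm θ - a * ρ * l1norm (θ - t))) ∂condPrior ρ δ
      ≤ ENNReal.ofReal (a⁻¹ ^ δ.card) := by
  have := isProbabilityMeasure_spikeSlab (δ := δ) hρ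
  have hprod (θ : Fin d → ℝ) :
      ENNReal.ofReal (exp (ρ * l1norm θ - a * ρ * l1norm (θ - t))) =
      ∏ j, ENNReal.ofReal (exp (ρ * |θ j| - a * ρ * |θ j - t j|)) := by
    rw [← ENNReal.ofReal_prod_of_nonneg fun j _ => (exp_pos _).le, ← exp_sum,
      Finset.sum_sub_distrib, ← Finset.mul_sum, ← Finset.mul_sum]
    rfl
  simp_rw [hprod]
  rw [condPrior_eq_pi, lintegral_pi_prod (μ := spikeSlab ρ δ)
    (f := fun j x => ENNReal.ofReal (exp (ρ * |x| - a * ρ * |x - t j|))) fun j => by fun_prop]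
  calc _ ≤ ∏ j : Fin d, if j ∈ δ then ENNReal.ofReal a⁻¹ else 1 :=
        Finset.prod_le_prod' fun j _ => lintegral_spikeSlab_exp_le hρ ha j (t j)
    _ = ENNReal.ofReal (a⁻¹ ^ δ.card) := by
        rw [ENNReal.ofReal_pow (by positivity)]
        simp

lemma spikeSlab_eq_map_add_withDensity {j : Fin d} {t : ℝ} (ht : j ∉ δ → t = 0) :
    spikeSlab ρ δ j = ((spikeSlab ρ δ j).map fun x => x + t).withDensity
      fun x => ENNReal.ofReal (exp (ρ * |x - t| - ρ * |x|)) := by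
  unfold spikeSlab
  split_ifs with hj
  · exact laplace_eq_map_add_withDensity t
  · simp [ht hj]

lemma condPrior_eq_map_add_withDensity (hρ : 0 < ρ) {t : Fin d → ℝ} (ht : supp t ⊆ δ) :
    condPrior ρ δ = ((condPrior ρ δ).map fun u => u + t).withDensity
      fun θ => ∏ j, ENNReal.ofReal (exp (ρ * |θ j - t j| - ρ * |θ j|)) := by
  have := isProbabilityMeasure_spikeSlab (δ := δ) hρ
  have (j : Fin d) : IsProbabilityMeasure ((spikeSlab ρ δ j).map fun x => x + t j) :=
    Measure.isProbabilityMeasure_map (by fun_prop)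
  have hshift (j : Fin d) := spikeSlab_eq_map_add_withDensity (ρ := ρ) (δ := δ) (j := j)
    fun hj => eq_zero_of_notMem_supp fun h => hj (ht h)
  have (j : Fin d) : SigmaFinite (((spikeSlab ρ δ j).map fun x => x + t j).withDensity
      fun x => ENNReal.ofReal (exp (ρ * |x - t j| - ρ * |x|))) :=
    hshift j ▸ inferInstance
  have hpi := pi_withDensity (μ := fun j => (spikeSlab ρ δ j).map fun x => x + t j)
    (f := fun j x => ENNReal.ofReal (exp (ρ * |x - t j| - ρ * |x|))) fun j => by fun_prop
  simp_rw [← hshift] at hpi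
  rwa [← Measure.pi_map_pi fun j => by fun_prop] at hpi

lemma le_lintegral_condPrior (hρ : 0 < ρ) {t : Fin d → ℝ} (ht : supp t ⊆ δ)
    {F : (Fin d → ℝ) → ℝ≥0∞} (hF : Measurable F) :
    ENNReal.ofReal (exp (-(ρ * l1norm t))) * ∫⁻ u, F (u + t) ∂condPrior ρ δ
      ≤ ∫⁻ θ, F θ ∂condPrior ρ δ := by
  have hmeas : Measurable fun θ : Fin d → ℝ =>
      ∏ j, ENNReal.ofReal (exp (ρ * |θ j - t j| - ρ * |θ j|)) := by fun_prop
  conv_rhs => rw [condPrior_eq_map_add_withDensity hρ ht]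
  rw [lintegral_withDensity_eq_lintegral_mul _ hmeas hF,
    lintegral_map (hmeas.mul hF) (by fun_prop), ← lintegral_const_mul _ (by fun_prop)]
  refine lintegral_mono fun u => mul_le_mul_left ?_ _
  beta_reduce
  rw [← ENNReal.ofReal_prod_of_nonneg fun j _ => (exp_pos _).le, ← exp_sum,
    Finset.sum_sub_distrib, ← Finset.mul_sum, ← Finset.mul_sum]
  have htriangle := mul_le_mul_of_nonneg_left (l1norm_add_le u t) hρ.le
  refine ENNReal.ofReal_le_ofReal (exp_le_exp.2 ?_)
  simp only [l1norm, Pi.add_apply, add_sub_cancel_right] at htriangle ⊢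
  linarith

lemma memLp_mul_spikeSlab (hρ : 0 < ρ) (j : Fin d) (c : ℝ) :
    MemLp (fun x => c * x) 2 (spikeSlab ρ δ j) := by
  refine MemLp.const_mul ((memLp_two_iff_integrable_sq (by fun_prop)).2 ?_) c
  unfold spikeSlab
  split_ifs
  · exact integrable_laplace_sq hρ
  · exact integrable_dirac (by simp)

lemma integral_spikeSlab (hρ : 0 < ρ) (j : Fin d) : ∫ x, x ∂spikeSlab ρ δ j = 0 := by
  unfold spikeSlab
  split_ifs
  · exact integral_laplace_id hρ
  · exact integral_dirac _ 0

lemma integral_spikeSlab_sq (hρ : 0 < ρ) (j : Fin d) :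
    ∫ x, x ^ 2 ∂spikeSlab ρ δ j = if j ∈ δ then 2 / ρ ^ 2 else 0 := by
  unfold spikeSlab
  split_ifs
  · exact integral_laplace_sq hρ
  · simp

lemma memLp_dotProduct (hρ : 0 < ρ) (c : Fin d → ℝ) :
    MemLp (fun u => c ⬝ᵥ u) 2 (condPrior ρ δ) := by
  have := isProbabilityMeasure_spikeSlab (δ := δ) hρ
  exact memLp_finsetSum Finset.univ fun j _ =>
    (memLp_mul_spikeSlab hρ j (c j)).comp_measurePreserving
      (measurePreserving_eval (spikeSlab ρ δ) j)

lemma integral_dotProduct (hρ : 0 < ρ) (c : Fin d → ℝ) : ∫ u, c ⬝ᵥ u ∂condPrior ρ δ = 0 := by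
  have := isProbabilityMeasure_spikeSlab (δ := δ) hρ
  have hint (j : Fin d) : Integrable (fun u : Fin d → ℝ => c j * u j) (condPrior ρ δ) :=
    ((memLp_mul_spikeSlab hρ j (c j)).comp_measurePreserving
      (measurePreserving_eval (spikeSlab ρ δ) j)).integrable (by norm_num)
  simp only [dotProduct]
  rw [integral_finsetSum _ fun j _ => hint j]
  refine Finset.sum_eq_zero fun j _ => ?_
  rw [integral_const_mul, condPrior_eq_pi,
    integral_comp_eval (μ := spikeSlab ρ δ) (f := fun x : ℝ => x) (by fun_prop),
    integral_spikeSlab hρ, mul_zero]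

lemma integral_dotProduct_sq (hρ : 0 < ρ) (c : Fin d → ℝ) :
    ∫ u, (c ⬝ᵥ u) ^ 2 ∂condPrior ρ δ = 2 / ρ ^ 2 * ∑ j ∈ δ, c j ^ 2 := by
  have := isProbabilityMeasure_spikeSlab (δ := δ) hρ
  have hsum : (fun u : Fin d → ℝ => c ⬝ᵥ u) = ∑ j, fun u => (fun x => c j * x) (u j) := by
    funext u
    simp [dotProduct]
  calc ∫ u, (c ⬝ᵥ u) ^ 2 ∂condPrior ρ δ = Var[fun u => c ⬝ᵥ u; condPrior ρ δ] :=
        (variance_of_integral_eq_zero (memLp_dotProduct hρ c).aestronglyMeasurable.aemeasurable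
          (integral_dotProduct hρ c)).symm
    _ = ∑ j, Var[fun x => c j * x; spikeSlab ρ δ j] := by
        rw [hsum, condPrior_eq_pi, variance_sum_pi fun j => memLp_mul_spikeSlab hρ j (c j)]
    _ = ∑ j, if j ∈ δ then 2 / ρ ^ 2 * c j ^ 2 else 0 := by
        refine Finset.sum_congr rfl fun j _ => ?_
        rw [variance_const_mul,
          variance_of_integral_eq_zero (by fun_prop) (integral_spikeSlab hρ j),
          integral_spikeSlab_sq hρ, mul_ite, mul_zero, mul_comm]
    _ = 2 / ρ ^ 2 * ∑ j ∈ δ, c j ^ 2 := by simp [Finset.mul_sum]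

end CondPrior

variable {n d : ℕ} {X : Matrix (Fin n) (Fin d) ℝ} {θs : Fin d → ℝ} {z : Fin n → ℝ} {ρ : ℝ}

section MaxNorm

lemma abs_le_maxNorm (i : Fin n) (j : Fin d) : |X i j| ≤ maxNorm X :=
  le_ciSup (f := fun p : Fin n × Fin d => |X p.1 p.2|) (Set.finite_range _).bddAbove (i, j)

lemma maxNorm_nonneg : 0 ≤ maxNorm X := Real.iSup_nonneg fun _ => abs_nonneg _

lemma abs_dotProduct_le (i : Fin n) (u : Fin d → ℝ) : |X i ⬝ᵥ u| ≤ maxNorm X * l1norm u := by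
  rw [l1norm, Finset.mul_sum]
  refine (Finset.abs_sum_le_sum_abs _ _).trans (Finset.sum_le_sum fun j _ => ?_)
  rw [abs_mul]
  gcongr
  exact abs_le_maxNorm i j

end MaxNorm

section LogLikelihood

/-- The score, that is, the gradient at `θs` of the log-likelihood `log q_θ(z)`. -/
noncomputable def score (X : Matrix (Fin n) (Fin d) ℝ) (θs : Fin d → ℝ) (z : Fin n → ℝ)
    (j : Fin d) : ℝ :=
  ∑ i, X i j * (z i - sigmoid (X i ⬝ᵥ θs))

/-- The remainder of the first order Taylor expansion at `θs` of `-log q_θ(z)`, in the direction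
`u`. Logistic regression is a canonical exponential family, so it does not depend on `z`. -/
noncomputable def remainder (X : Matrix (Fin n) (Fin d) ℝ) (θs u : Fin d → ℝ) : ℝ :=
  ∑ i, bregman (X i ⬝ᵥ θs) (X i ⬝ᵥ u)

/-- The logarithm of the likelihood ratio of `θ` against `θs`, both likelihoods being penalized by
the factor `exp (-ρ‖·‖₁)` of the Laplace density. -/
noncomputable def logRatio (X : Matrix (Fin n) (Fin d) ℝ) (ρ : ℝ) (θs : Fin d → ℝ) (z : Fin n → ℝ)
    (θ : Fin d → ℝ) : ℝ :=
  score X θs z ⬝ᵥ (θ - θs) - remainder X θs (θ - θs) + ρ * l1norm θs - ρ * l1norm θ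

lemma likelihood_pos (θ : Fin d → ℝ) : 0 < likelihood X θ z := exp_pos _

lemma continuous_likelihood : Continuous fun θ => likelihood X θ z := by
  have := continuous_g
  unfold likelihood dotProduct
  fun_prop

lemma score_dotProduct (u : Fin d → ℝ) :
    score X θs z ⬝ᵥ u = ∑ i, (z i - sigmoid (X i ⬝ᵥ θs)) * (X i ⬝ᵥ u) := by
  simp only [score, dotProduct, Finset.sum_mul, Finset.mul_sum]
  rw [Finset.sum_comm]
  exact Finset.sum_congr rfl fun i _ => Finset.sum_congr rfl fun j _ => by ring

lemma likelihood_add (u : Fin d → ℝ) :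
    likelihood X (u + θs) z =
      likelihood X θs z * exp (score X θs z ⬝ᵥ u - remainder X θs u) := by
  rw [likelihood, likelihood, ← exp_add, score_dotProduct, remainder, ← Finset.sum_sub_distrib,
    ← Finset.sum_add_distrib]
  refine congrArg exp (Finset.sum_congr rfl fun i _ => ?_)
  rw [dotProduct_add, bregman, add_comm (X i ⬝ᵥ u)]
  ring

lemma likelihood_eq_mul_exp_logRatio (θ : Fin d → ℝ) :
    likelihood X θ z =
      likelihood X θs z * exp (-(ρ * l1norm θs)) * exp (logRatio X ρ θs z θ + ρ * l1norm θ) := by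
  rw [← sub_add_cancel θ θs, likelihood_add, mul_assoc, ← exp_add, sub_add_cancel, logRatio]
  ring_nf

lemma remainder_nonneg (u : Fin d → ℝ) : 0 ≤ remainder X θs u :=
  Finset.sum_nonneg fun _ _ => bregman_nonneg _ _

lemma remainder_le (u : Fin d → ℝ) : remainder X θs u ≤ ∑ i, (X i ⬝ᵥ u) ^ 2 / 8 :=
  Finset.sum_le_sum fun _ _ => bregman_le _ _

lemma continuous_remainder : Continuous (remainder X θs) := by
  unfold remainder dotProduct
  exact continuous_finsetSum _ fun i _ => (continuous_bregman _).comp (by fun_prop)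

end LogLikelihood

section Evidence

lemma integrable_sum_sq_dotProduct (hρ : 0 < ρ) (δ : Finset (Fin d)) :
    Integrable (fun u => ∑ i, (X i ⬝ᵥ u) ^ 2 / 8) (condPrior ρ δ) :=
  integrable_finsetSum _ fun i _ => (memLp_dotProduct hρ (X i)).integrable_sq.div_const 8

lemma integrable_remainder (hρ : 0 < ρ) (δ : Finset (Fin d)) :
    Integrable (remainder X θs) (condPrior ρ δ) :=
  (integrable_sum_sq_dotProduct hρ δ).mono' continuous_remainder.aestronglyMeasurable
    (ae_of_all _ fun u => by
      simpa only [norm_of_nonneg (remainder_nonneg u)] using remainder_le u)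

lemma integral_remainder_le (hρ : 0 < ρ) (hX : n * maxNorm X ^ 2 ≤ ρ ^ 2)
    (δ : Finset (Fin d)) : ∫ u, remainder X θs u ∂condPrior ρ δ ≤ δ.card / 4 := by
  calc ∫ u, remainder X θs u ∂condPrior ρ δ
      ≤ ∫ u, ∑ i, (X i ⬝ᵥ u) ^ 2 / 8 ∂condPrior ρ δ :=
        integral_mono (integrable_remainder hρ δ) (integrable_sum_sq_dotProduct hρ δ) remainder_le
    _ = ∑ i, 2 / ρ ^ 2 * (∑ j ∈ δ, X i j ^ 2) / 8 := by
        rw [integral_finsetSum _ fun i _ =>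
          (memLp_dotProduct hρ (X i)).integrable_sq.div_const 8]
        simp_rw [integral_div, integral_dotProduct_sq hρ]
    _ ≤ ∑ i : Fin n, 2 / ρ ^ 2 * (∑ j ∈ δ, maxNorm X ^ 2) / 8 := by
        gcongr ∑ i, 2 / ρ ^ 2 * (∑ j ∈ δ, ?_) / 8 with i _ j _
        exact sq_le_sq.2 ((abs_le_maxNorm i j).trans (le_abs_self _))
    _ = δ.card / 4 * (n * maxNorm X ^ 2 / ρ ^ 2) := by
        simp only [Finset.sum_const, Finset.card_univ, Fintype.card_fin, nsmul_eq_mul]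
        ring
    _ ≤ δ.card / 4 := mul_le_of_le_one_right (by positivity) (div_le_one_of_le₀ hX (by positivity))

lemma le_lintegral_likelihood (hρ : 0 < ρ) (hX : n * maxNorm X ^ 2 ≤ ρ ^ 2) :
    ENNReal.ofReal (likelihood X θs z * exp (-(ρ * l1norm θs)) * exp (-(l0norm θs / 4)))
      ≤ ∫⁻ θ, ENNReal.ofReal (likelihood X θ z) ∂condPrior ρ (supp θs) := by
  have := isProbabilityMeasure_condPrior (δ := supp θs) hρ
  have hscore : Integrable (fun u => score X θs z ⬝ᵥ u) (condPrior ρ (supp θs)) :=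
    (memLp_dotProduct hρ (score X θs z)).integrable (by norm_num)
  have hrem := integrable_remainder (X := X) (θs := θs) hρ (supp θs)
  have hmean : -(l0norm θs / 4 : ℝ) ≤
      ∫ u, (score X θs z ⬝ᵥ u - remainder X θs u) ∂condPrior ρ (supp θs) := by
    rw [integral_sub hscore hrem, integral_dotProduct hρ, zero_sub]
    exact neg_le_neg (integral_remainder_le hρ hX _)
  calc ENNReal.ofReal (likelihood X θs z * exp (-(ρ * l1norm θs)) * exp (-(l0norm θs / 4)))
      = ENNReal.ofReal (exp (-(ρ * l1norm θs))) * (ENNReal.ofReal (likelihood X θs z) *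
          ENNReal.ofReal (exp (-(l0norm θs / 4)))) := by
        rw [mul_comm (likelihood X θs z), mul_assoc, ENNReal.ofReal_mul (exp_pos _).le,
          ENNReal.ofReal_mul (likelihood_pos _).le]
    _ ≤ ENNReal.ofReal (exp (-(ρ * l1norm θs))) * (ENNReal.ofReal (likelihood X θs z) *
          ∫⁻ u, ENNReal.ofReal (exp (score X θs z ⬝ᵥ u - remainder X θs u))
            ∂condPrior ρ (supp θs)) := by
        gcongr
        exact (ENNReal.ofReal_le_ofReal (exp_le_exp.2 hmean)).trans
          (ofReal_exp_integral_le_lintegral (hscore.sub hrem))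
    _ = ENNReal.ofReal (exp (-(ρ * l1norm θs))) *
          ∫⁻ u, ENNReal.ofReal (likelihood X (u + θs) z) ∂condPrior ρ (supp θs) := by
        rw [← lintegral_const_mul' _ _ ENNReal.ofReal_ne_top]
        simp_rw [likelihood_add, ENNReal.ofReal_mul (likelihood_pos _).le]
    _ ≤ ∫⁻ θ, ENNReal.ofReal (likelihood X θ z) ∂condPrior ρ (supp θs) :=
        le_lintegral_condPrior hρ subset_rfl continuous_likelihood.measurable.ennreal_ofReal

end Evidence

section Posterior

variable {w : Finset (Fin d) → ℝ} {B : Set (Fin d → ℝ)} {a b : ℝ}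

lemma posterior_le_one : posterior X ρ w z B ≤ 1 := by
  refine (measure_mono (Set.subset_univ B)).trans ?_
  rw [posterior, Measure.smul_apply, withDensity_apply _ MeasurableSet.univ, setLIntegral_univ,
    smul_eq_mul]
  exact ENNReal.inv_mul_le_one _

lemma setLIntegral_prior (f : (Fin d → ℝ) → ℝ≥0∞) :
    ∫⁻ θ in B, f θ ∂prior ρ w =
      ∑ δ, ENNReal.ofReal (w δ) * ∫⁻ θ in B, f θ ∂condPrior ρ δ := by
  unfold prior
  rw [← Measure.restrictₗ_apply, map_sum, lintegral_finsetSum_measure]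
  refine Finset.sum_congr rfl fun δ _ => ?_
  rw [Measure.restrictₗ_apply, Measure.restrict_smul, lintegral_smul_measure, smul_eq_mul]

lemma setLIntegral_likelihood_le (hρ : 0 < ρ) (ha : 0 < a) (hB : MeasurableSet B)
    (hb : ∀ θ ∈ B, logRatio X ρ θs z θ ≤ b - a * ρ * l1norm (θ - θs)) (δ : Finset (Fin d)) :
    ∫⁻ θ in B, ENNReal.ofReal (likelihood X θ z) ∂condPrior ρ δ ≤ ENNReal.ofReal
      (likelihood X θs z * exp (-(ρ * l1norm θs)) * exp b * a⁻¹ ^ δ.card) := by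
  set C := likelihood X θs z * exp (-(ρ * l1norm θs)) with hC
  have hC0 : 0 < C := mul_pos (likelihood_pos θs) (exp_pos _)
  calc ∫⁻ θ in B, ENNReal.ofReal (likelihood X θ z) ∂condPrior ρ δ
      ≤ ∫⁻ θ in B, ENNReal.ofReal (C * exp b) *
          ENNReal.ofReal (exp (ρ * l1norm θ - a * ρ * l1norm (θ - θs))) ∂condPrior ρ δ := by
        refine setLIntegral_mono' hB fun θ hθ => ?_
        rw [← ENNReal.ofReal_mul (by positivity), mul_assoc, ← exp_add,
          likelihood_eq_mul_exp_logRatio θ, ← hC]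
        refine ENNReal.ofReal_le_ofReal (mul_le_mul_of_nonneg_left (exp_le_exp.2 ?_) hC0.le)
        linarith [hb θ hθ]
    _ ≤ ∫⁻ θ, ENNReal.ofReal (C * exp b) *
          ENNReal.ofReal (exp (ρ * l1norm θ - a * ρ * l1norm (θ - θs))) ∂condPrior ρ δ :=
        setLIntegral_le_lintegral _ _
    _ ≤ ENNReal.ofReal (C * exp b) * ENNReal.ofReal (a⁻¹ ^ δ.card) := by
        rw [lintegral_const_mul' _ _ ENNReal.ofReal_ne_top]
        gcongr
        exact lintegral_condPrior_exp_le hρ ha θs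
    _ = ENNReal.ofReal (C * exp b * a⁻¹ ^ δ.card) := (ENNReal.ofReal_mul (by positivity)).symm

lemma setLIntegral_prior_likelihood_le (hρ : 0 < ρ) (hw : ∀ δ, 0 ≤ w δ) (ha : 0 < a)
    (hB : MeasurableSet B)
    (hb : ∀ θ ∈ B, logRatio X ρ θs z θ ≤ b - a * ρ * l1norm (θ - θs))
    {D : Finset (Finset (Fin d))} (hD : ∀ δ, δ ∉ D → condPrior ρ δ B = 0) :
    ∫⁻ θ in B, ENNReal.ofReal (likelihood X θ z) ∂prior ρ w ≤ ENNReal.ofReal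
      (likelihood X θs z * exp (-(ρ * l1norm θs)) * exp b * ∑ δ ∈ D, w δ * a⁻¹ ^ δ.card) := by
  have hC0 := mul_pos (likelihood_pos (X := X) (z := z) θs) (exp_pos (-(ρ * l1norm θs)))
  rw [setLIntegral_prior, ← Finset.sum_subset (Finset.subset_univ D), Finset.mul_sum,
    ENNReal.ofReal_sum_of_nonneg fun δ _ => by have := hw δ; positivity]
  · refine Finset.sum_le_sum fun δ _ => ?_
    rw [mul_left_comm, ENNReal.ofReal_mul (hw δ)]
    gcongr
    exact setLIntegral_likelihood_le hρ ha hB hb δ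
  · intro δ _ hδ
    rw [Measure.restrict_eq_zero.2 (hD δ hδ), lintegral_zero_measure, mul_zero]

lemma le_lintegral_prior_likelihood (hρ : 0 < ρ) (hX : n * maxNorm X ^ 2 ≤ ρ ^ 2)
    (hws : 0 ≤ w (supp θs)) :
    ENNReal.ofReal (w (supp θs) *
        (likelihood X θs z * exp (-(ρ * l1norm θs)) * exp (-(l0norm θs / 4)))) ≤
      ∫⁻ θ, ENNReal.ofReal (likelihood X θ z) ∂prior ρ w := by
  rw [← setLIntegral_univ, setLIntegral_prior]
  refine le_trans ?_ (Finset.single_le_sum (fun δ _ => zero_le) (Finset.mem_univ (supp θs)))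
  rw [ENNReal.ofReal_mul hws, setLIntegral_univ]
  gcongr
  exact le_lintegral_likelihood hρ hX

lemma posterior_le (hρ : 0 < ρ) (hX : n * maxNorm X ^ 2 ≤ ρ ^ 2) (hw : ∀ δ, 0 ≤ w δ)
    (hws : 0 < w (supp θs)) (ha : 0 < a) (hB : MeasurableSet B)
    (hb : ∀ θ ∈ B, logRatio X ρ θs z θ ≤ b - a * ρ * l1norm (θ - θs))
    {D : Finset (Finset (Fin d))} (hD : ∀ δ, δ ∉ D → condPrior ρ δ B = 0) :
    posterior X ρ w z B ≤ ENNReal.ofReal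
      (exp (b + l0norm θs / 4) * (∑ δ ∈ D, w δ * a⁻¹ ^ δ.card) / w (supp θs)) := by
  have hC0 := mul_pos (likelihood_pos (X := X) (z := z) θs) (exp_pos (-(ρ * l1norm θs)))
  rw [posterior, Measure.smul_apply, withDensity_apply _ hB, smul_eq_mul, mul_comm,
    ← div_eq_mul_inv]
  refine (ENNReal.div_le_div (setLIntegral_prior_likelihood_le hρ hw ha hB hb hD)
    (le_lintegral_prior_likelihood hρ hX hws.le)).trans_eq ?_
  rw [← ENNReal.ofReal_div_of_pos (by positivity)]
  congr 1
  generalize likelihood X θs z * exp (-(ρ * l1norm θs)) = C at hC0 ⊢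
  rw [exp_neg, exp_add]
  field_simp

end Posterior

section SparseVectors

lemma l0norm_sub_le (θ θ' : Fin d → ℝ) : l0norm (θ - θ') ≤ l0norm θ + l0norm θ' := by
  refine (Finset.card_le_card fun j hj => ?_).trans (Finset.card_union_le (supp θ) (supp θ'))
  contrapose! hj
  rw [Finset.notMem_union] at hj
  simp [mem_supp, eq_zero_of_notMem_supp hj.1, eq_zero_of_notMem_supp hj.2]

lemma one_le_l0norm {u : Fin d → ℝ} (hu : u ≠ 0) : 1 ≤ l0norm u := by
  obtain ⟨j, hj⟩ := Function.ne_iff.1 hu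
  exact Finset.card_pos.2 ⟨j, mem_supp.2 hj⟩

lemma l0norm_single (j : Fin d) : l0norm (Pi.single j 1) = 1 := by
  refine Finset.card_eq_one.2 ⟨j, ?_⟩
  ext i
  simp [mem_supp, Pi.single_apply]

lemma l2norm_nonneg (u : Fin d → ℝ) : 0 ≤ l2norm u := norm_nonneg _

lemma l2norm_sq (u : Fin d → ℝ) : l2norm u ^ 2 = ∑ j, u j ^ 2 := by
  simp [l2norm, EuclideanSpace.norm_sq_eq]

lemma l2norm_le_l1norm (u : Fin d → ℝ) : l2norm u ≤ l1norm u := by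
  refine le_of_sq_le_sq ?_ (l1norm_nonneg u)
  rw [l2norm_sq, ← Finset.sum_congr rfl fun j _ => sq_abs (u j)]
  exact Finset.sum_sq_le_sq_sum_of_nonneg fun _ _ => abs_nonneg _

lemma l1norm_eq_sum_add_sum_compl (u : Fin d → ℝ) (S : Finset (Fin d)) :
    l1norm u = ∑ j ∈ S, |u j| + ∑ j ∈ Sᶜ, |u j| :=
  (Finset.sum_add_sum_compl S fun j => |u j|).symm

lemma sq_sum_abs_le (S : Finset (Fin d)) (u : Fin d → ℝ) :
    (∑ j ∈ S, |u j|) ^ 2 ≤ S.card * l2norm u ^ 2 := by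
  calc (∑ j ∈ S, |u j|) ^ 2 ≤ S.card * ∑ j ∈ S, |u j| ^ 2 := sq_sum_le_card_mul_sum_sq
    _ ≤ S.card * l2norm u ^ 2 := by
        rw [l2norm_sq]
        simp only [sq_abs]
        gcongr
        exact Finset.subset_univ S

lemma l1norm_le_sqrt_mul_l2norm {s : ℕ} {u : Fin d → ℝ} (hu : l0norm u ≤ s) :
    l1norm u ≤ √s * l2norm u := by
  have hsupp : l1norm u = ∑ j ∈ supp u, |u j| :=
    (Finset.sum_subset (Finset.subset_univ _) fun j _ hj => by
      rw [eq_zero_of_notMem_supp hj, abs_zero]).symm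
  refine le_of_sq_le_sq ?_ (mul_nonneg (sqrt_nonneg _) (l2norm_nonneg u))
  rw [mul_pow, sq_sqrt (Nat.cast_nonneg s), hsupp]
  refine (sq_sum_abs_le (supp u) u).trans ?_
  gcongr
  exact hu

end SparseVectors

section RestrictedEigenvalues

variable {s : ℕ}

/-- The quadratic form `u'(X'WX)u` of the Fisher information at `θs`. -/
noncomputable def fisher (X : Matrix (Fin n) (Fin d) ℝ) (θs u : Fin d → ℝ) : ℝ :=
  ∑ i, sigmoid (X i ⬝ᵥ θs) * (1 - sigmoid (X i ⬝ᵥ θs)) * (X i ⬝ᵥ u) ^ 2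

lemma fisher_nonneg (u : Fin d → ℝ) : 0 ≤ fisher X θs u :=
  Finset.sum_nonneg fun _ _ => mul_nonneg (sigmoid_mul_one_sub_nonneg _) (sq_nonneg _)

lemma quotient_weight (u : Fin d → ℝ) :
    quotient n (X.transpose * weight X θs * X) u = fisher X θs u / (n * l2norm u ^ 2) := by
  unfold quotient
  congr 1
  rw [← Matrix.mulVec_mulVec, ← Matrix.mulVec_mulVec, Matrix.dotProduct_mulVec,
    Matrix.vecMul_transpose]
  simp only [weight, fisher, dotProduct, Matrix.mulVec_diagonal, deriv_deriv_g]
  refine Finset.sum_congr rfl fun i _ => ?_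
  simp only [Matrix.mulVec, dotProduct]
  ring

lemma quotient_weight_nonneg (u : Fin d → ℝ) :
    0 ≤ quotient n (X.transpose * weight X θs * X) u := by
  have := fisher_nonneg (X := X) (θs := θs) u
  rw [quotient_weight]
  positivity

lemma mul_le_fisher {κ : ℝ} {u : Fin d → ℝ}
    (h : κ ≤ quotient n (X.transpose * weight X θs * X) u) :
    κ * (n * l2norm u ^ 2) ≤ fisher X θs u := by
  rcases (show (0 : ℝ) ≤ n * l2norm u ^ 2 by positivity).eq_or_lt with h0 | h0
  · rw [← h0, mul_zero]
    exact fisher_nonneg u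
  · rwa [quotient_weight, le_div_iff₀ h0] at h

lemma fisher_div_le_remainder (u : Fin d → ℝ) :
    fisher X θs u / (2 + maxNorm X * l1norm u) ≤ remainder X θs u := by
  unfold fisher remainder
  rw [Finset.sum_div]
  refine Finset.sum_le_sum fun i _ => le_trans ?_ (le_bregman _ _)
  rw [mul_div_assoc]
  have := sigmoid_mul_one_sub_nonneg (X i ⬝ᵥ θs)
  gcongr
  exact abs_dotProduct_le i u

lemma kappaSparse_le {u : Fin d → ℝ} (hu : u ≠ 0) (hs : l0norm u ≤ s) :
    kappaSparse X θs s ≤ quotient n (X.transpose * weight X θs * X) u := by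
  refine csInf_le ⟨0, ?_⟩ ⟨u, ⟨one_le_l0norm hu, hs⟩, rfl⟩
  rintro _ ⟨v, -, rfl⟩
  exact quotient_weight_nonneg v

lemma kappaSparse_mul_le_fisher {u : Fin d → ℝ} (hs : l0norm u ≤ s) :
    kappaSparse X θs s * (n * l2norm u ^ 2) ≤ fisher X θs u := by
  rcases eq_or_ne u 0 with rfl | hu
  · simp [l2norm, fisher]
  · exact mul_le_fisher (kappaSparse_le hu hs)

lemma fisher_single_le (j : Fin d) : fisher X θs (Pi.single j 1) ≤ n * maxNorm X ^ 2 := by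
  refine (Finset.sum_le_card_nsmul _ _ (maxNorm X ^ 2) fun i _ => ?_).trans (by simp)
  rw [dotProduct_single, mul_one, ← one_mul (maxNorm X ^ 2), ← sq_abs (X i j)]
  gcongr
  · linarith [sigmoid_mul_one_sub_le (X i ⬝ᵥ θs)]
  · exact abs_le_maxNorm i j

lemma kappaSparse_le_maxNorm_sq : kappaSparse X θs s ≤ maxNorm X ^ 2 := by
  rcases Set.eq_empty_or_nonempty {u : Fin d → ℝ | 1 ≤ l0norm u ∧ l0norm u ≤ s} with h | h
  · rw [kappaSparse, h, Set.image_empty, sInf_empty]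
    positivity
  · obtain ⟨u, hu1, hus⟩ := h
    obtain ⟨j, -⟩ := Finset.card_pos.1 hu1
    have hl2 : l2norm (Pi.single j 1 : Fin d → ℝ) = 1 := by simp [l2norm]
    refine (kappaSparse_le (u := Pi.single j 1) (by simp)
      ((l0norm_single j).trans_le (hu1.trans hus))).trans ?_
    rw [quotient_weight, hl2, one_pow, mul_one]
    exact div_le_of_le_mul₀ (by positivity) (by positivity)
      ((fisher_single_le j).trans_eq (mul_comm _ _))

lemma maxNorm_pos_of_kappaSparse_pos (h : 0 < kappaSparse X θs s) : 0 < maxNorm X :=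
  maxNorm_nonneg.lt_of_ne' fun h0 => by
    have := h.trans_le kappaSparse_le_maxNorm_sq
    simp [h0] at this

lemma pos_of_maxNorm_pos (h : 0 < maxNorm X) : 0 < n := by
  refine Nat.pos_of_ne_zero ?_
  rintro rfl
  simp [maxNorm] at h

/-- `κ` is a compatibility constant when the Fisher information dominates `κ n‖u‖₂²` on the cone
that defines `kappa`. This holds for every real number below `kappa`, and in particular it separates
what is needed of `kappa` from its value `+∞` at `θs = 0`. -/
def IsCompatibilityConst (X : Matrix (Fin n) (Fin d) ℝ) (θs : Fin d → ℝ) (κ : ℝ) : Prop :=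
  ∀ u : Fin d → ℝ, ∑ j ∈ (supp θs)ᶜ, |u j| ≤ 7 * ∑ j ∈ supp θs, |u j| →
    κ * (n * l2norm u ^ 2) ≤ fisher X θs u

lemma isCompatibilityConst_toReal {κ : EReal} (hκ : 0 < κ) (h : κ ≤ kappa X θs) :
    IsCompatibilityConst X θs κ.toReal := by
  intro u hu
  rcases eq_or_ne u 0 with rfl | hu0
  · simp [l2norm, fisher]
  · refine mul_le_fisher ?_
    have hquot := h.trans (iInf₂_le u ⟨hu0, hu⟩)
    exact EReal.toReal_le_toReal hquot (ne_bot_of_gt hκ) (EReal.coe_ne_top _)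

lemma kappa_ne_top (hs : l0norm θs ≠ 0) : kappa X θs ≠ ⊤ := by
  have hθs : θs ≠ 0 := by
    rintro rfl
    simp [l0norm, supp] at hs
  have hcone : ∑ j ∈ (supp θs)ᶜ, |θs j| ≤ 7 * ∑ j ∈ supp θs, |θs j| := by
    rw [Finset.sum_eq_zero fun j hj => by
      rw [eq_zero_of_notMem_supp (Finset.mem_compl.1 hj), abs_zero]]
    positivity
  exact ne_top_of_le_ne_top (EReal.coe_ne_top _) (iInf₂_le θs ⟨hθs, hcone⟩)

end RestrictedEigenvalues

section PenalizedScore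

/-- The event on which the `ℓ₁` penalty dominates the score: all scores are at most `ρ / 2`. -/
def ScoreBounded (X : Matrix (Fin n) (Fin d) ℝ) (ρ : ℝ) (θs : Fin d → ℝ) (z : Fin n → ℝ) : Prop :=
  ∀ j, |score X θs z j| ≤ ρ / 2

lemma ScoreBounded.score_dotProduct_le (hz : ScoreBounded X ρ θs z) (u : Fin d → ℝ) :
    score X θs z ⬝ᵥ u ≤ ρ / 2 * l1norm u := by
  rw [l1norm, Finset.mul_sum]
  refine Finset.sum_le_sum fun j _ => (le_abs_self _).trans ?_
  rw [abs_mul]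
  exact mul_le_mul_of_nonneg_right (hz j) (abs_nonneg _)

lemma l1norm_sub_l1norm_le (θ θ' : Fin d → ℝ) :
    l1norm θ' - l1norm θ ≤
      ∑ j ∈ supp θ', |(θ - θ') j| - ∑ j ∈ (supp θ')ᶜ, |(θ - θ') j| := by
  have hcompl {j : Fin d} (hj : j ∈ (supp θ')ᶜ) : θ' j = 0 :=
    eq_zero_of_notMem_supp (Finset.mem_compl.1 hj)
  have hsupp : ∑ j ∈ supp θ', |θ' j| - ∑ j ∈ supp θ', |θ j| ≤ ∑ j ∈ supp θ', |(θ - θ') j| := by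
    rw [← Finset.sum_sub_distrib]
    refine Finset.sum_le_sum fun j _ => ?_
    rw [Pi.sub_apply, abs_sub_comm]
    exact abs_sub_abs_le_abs_sub _ _
  have hθ' : ∑ j ∈ (supp θ')ᶜ, |θ' j| = 0 := Finset.sum_eq_zero fun j hj => by simp [hcompl hj]
  have hθ : ∑ j ∈ (supp θ')ᶜ, |θ j| = ∑ j ∈ (supp θ')ᶜ, |(θ - θ') j| :=
    Finset.sum_congr rfl fun j hj => by simp [hcompl hj]
  rw [l1norm_eq_sum_add_sum_compl θ (supp θ'), l1norm_eq_sum_add_sum_compl θ' (supp θ'), hθ', hθ]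
  linarith

lemma ScoreBounded.logRatio_le (hz : ScoreBounded X ρ θs z) (hρ : 0 ≤ ρ) (θ : Fin d → ℝ) :
    logRatio X ρ θs z θ ≤ 3 / 2 * ρ * ∑ j ∈ supp θs, |(θ - θs) j|
      - 1 / 2 * ρ * ∑ j ∈ (supp θs)ᶜ, |(θ - θs) j| - remainder X θs (θ - θs) := by
  have hscore := hz.score_dotProduct_le (θ - θs)
  have hpenalty := mul_le_mul_of_nonneg_left (l1norm_sub_l1norm_le θ θs) hρ
  rw [l1norm_eq_sum_add_sum_compl (θ - θs) (supp θs)] at hscore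
  unfold logRatio
  linarith

end PenalizedScore

section Compatibility

variable {κ : ℝ}

lemma mul_sub_sq_div_two_add_le {a c k r : ℝ} (ha : 0 ≤ a) (hc : 0 < c) (hk : 0 ≤ k)
    (hrk : 2 * r * k ≤ c) : r * a - c * a ^ 2 / (2 + k * a) ≤ r ^ 2 / c := by
  have hpos : 0 < 2 + k * a := by positivity
  have hamgm : 2 * r * a ≤ 2 * (r ^ 2 / c) + c * a ^ 2 / 2 := by
    have hsq : 2 * (r ^ 2 / c) + c * a ^ 2 / 2 - 2 * r * a = (2 * r - c * a) ^ 2 / (2 * c) := by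
      field_simp
      ring
    linarith [show 0 ≤ (2 * r - c * a) ^ 2 / (2 * c) by positivity]
  rw [sub_le_iff_le_add', ← sub_le_iff_le_add, le_div_iff₀ hpos]
  have hsmall : 2 * r * k * a ^ 2 ≤ c * a ^ 2 := by gcongr
  have hextra : 0 ≤ r ^ 2 / c * (k * a) := by positivity
  linarith

lemma rho_nonneg : 0 ≤ rho X :=
  mul_nonneg (mul_nonneg zero_le_four maxNorm_nonneg) (sqrt_nonneg _)

lemma rho_pos (hM : 0 < maxNorm X) (hℓ : 0 < log d) : 0 < rho X := by
  have hn : (0 : ℝ) < n := Nat.cast_pos.2 (pos_of_maxNorm_pos hM)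
  unfold rho
  positivity

lemma rho_sq : rho X ^ 2 = 16 * maxNorm X ^ 2 * (n * log d) := by
  rw [rho, mul_pow, sq_sqrt (by positivity)]
  ring

/-- The sample size condition of the theorem, for the restricted eigenvalue `κ`. The universal
constant is `112 ^ 2`, which makes the condition equivalent to `112 ‖X‖_∞² s⋆ √(log d) ≤ κ √n`. -/
def SampleSizeBound (X : Matrix (Fin n) (Fin d) ℝ) (θs : Fin d → ℝ) (κ : ℝ) : Prop :=
  112 ^ 2 * maxNorm X ^ 4 * (l0norm θs / κ) ^ 2 * log d ≤ n

lemma SampleSizeBound.mul_rho_le (h : SampleSizeBound X θs κ) (hκ : 0 < κ) :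
    28 * maxNorm X * rho X * l0norm θs ≤ κ * n := by
  refine le_of_sq_le_sq ?_ (by positivity)
  calc (28 * maxNorm X * rho X * l0norm θs) ^ 2
      = 112 ^ 2 * maxNorm X ^ 4 * (l0norm θs / κ) ^ 2 * log d * (n * κ ^ 2) := by
        rw [mul_pow, mul_pow, rho_sq]
        field_simp
        ring
    _ ≤ n * (n * κ ^ 2) := by
        gcongr
        exact h
    _ = (κ * n) ^ 2 := by ring

lemma IsCompatibilityConst.le_remainder (hcompat : IsCompatibilityConst X θs κ) (hκ : 0 ≤ κ)
    (hs : 0 < l0norm θs) {u : Fin d → ℝ}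
    (hu : ∑ j ∈ (supp θs)ᶜ, |u j| ≤ 7 * ∑ j ∈ supp θs, |u j|) :
    κ * n / l0norm θs * (∑ j ∈ supp θs, |u j|) ^ 2
      / (2 + 8 * maxNorm X * ∑ j ∈ supp θs, |u j|) ≤ remainder X θs u := by
  have : (0 : ℝ) < l0norm θs := Nat.cast_pos.2 hs
  have hM := maxNorm_nonneg (X := X)
  have hfisher : κ * n / l0norm θs * (∑ j ∈ supp θs, |u j|) ^ 2 ≤ fisher X θs u :=
    calc κ * n / l0norm θs * (∑ j ∈ supp θs, |u j|) ^ 2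
        ≤ κ * n / l0norm θs * (l0norm θs * l2norm u ^ 2) := by
          gcongr
          exact sq_sum_abs_le (supp θs) u
      _ = κ * (n * l2norm u ^ 2) := by field_simp
      _ ≤ fisher X θs u := hcompat u hu
  have hl1 : l1norm u ≤ 8 * ∑ j ∈ supp θs, |u j| := by
    rw [l1norm_eq_sum_add_sum_compl u (supp θs)]
    linarith
  have hden : 0 < 2 + maxNorm X * l1norm u := by
    have := l1norm_nonneg u
    positivity
  refine le_trans (div_le_div₀ (fisher_nonneg u) hfisher hden ?_) (fisher_div_le_remainder u)
  linarith [mul_le_mul_of_nonneg_left hl1 hM]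

lemma IsCompatibilityConst.mul_rho_sub_remainder_le (hcompat : IsCompatibilityConst X θs κ)
    (hκ : 0 < κ) (hn : 0 < n) (hsize : SampleSizeBound X θs κ) {u : Fin d → ℝ}
    (hu : ∑ j ∈ (supp θs)ᶜ, |u j| ≤ 7 * ∑ j ∈ supp θs, |u j|) :
    7 / 4 * rho X * ∑ j ∈ supp θs, |u j| - remainder X θs u
      ≤ 64 * maxNorm X ^ 2 / κ * l0norm θs * log d := by
  have hM := maxNorm_nonneg (X := X)
  have ha : 0 ≤ ∑ j ∈ supp θs, |u j| := Finset.sum_nonneg fun _ _ => abs_nonneg _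
  have : (0 : ℝ) < n := Nat.cast_pos.2 hn
  rcases Nat.eq_zero_or_pos (l0norm θs) with hs | hs
  · rw [Finset.card_eq_zero.1 hs, hs]
    simpa using remainder_nonneg u
  have hs' : (0 : ℝ) < l0norm θs := Nat.cast_pos.2 hs
  have hsmall : 2 * (7 / 4 * rho X) * (8 * maxNorm X) ≤ κ * n / l0norm θs := by
    rw [le_div_iff₀ hs']
    linarith [hsize.mul_rho_le hκ]
  calc 7 / 4 * rho X * ∑ j ∈ supp θs, |u j| - remainder X θs u
      ≤ (7 / 4 * rho X) ^ 2 / (κ * n / l0norm θs) :=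
        (sub_le_sub_left (hcompat.le_remainder hκ.le hs hu) _).trans
          (mul_sub_sq_div_two_add_le ha (by positivity) (by positivity) hsmall)
    _ = 49 * (maxNorm X ^ 2 / κ * l0norm θs * log d) := by
        rw [mul_pow, rho_sq]
        field_simp
        ring
    _ ≤ 64 * (maxNorm X ^ 2 / κ * l0norm θs * log d) := by gcongr; norm_num
    _ = 64 * maxNorm X ^ 2 / κ * l0norm θs * log d := by ring

lemma ScoreBounded.logRatio_le_sub_l1norm (hz : ScoreBounded X (rho X) θs z)
    (hcompat : IsCompatibilityConst X θs κ) (hκ : 0 < κ) (hn : 0 < n)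
    (hsize : SampleSizeBound X θs κ) (θ : Fin d → ℝ) :
    logRatio X (rho X) θs z θ ≤
      64 * maxNorm X ^ 2 / κ * l0norm θs * log d - 1 / 4 * rho X * l1norm (θ - θs) := by
  have hρ := rho_nonneg (X := X)
  refine (hz.logRatio_le hρ θ).trans ?_
  rw [l1norm_eq_sum_add_sum_compl (θ - θs) (supp θs)]
  set a := ∑ j ∈ supp θs, |(θ - θs) j|
  set b := ∑ j ∈ (supp θs)ᶜ, |(θ - θs) j|
  have hb : 0 ≤ rho X * b := mul_nonneg hρ (Finset.sum_nonneg fun _ _ => abs_nonneg _)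
  rcases le_or_gt b (7 * a) with hcone | hcone
  · linarith [hcompat.mul_rho_sub_remainder_le hκ hn hsize hcone]
  · have hrem := remainder_nonneg (X := X) (θs := θs) (θ - θs)
    have hbound : 0 ≤ 64 * maxNorm X ^ 2 / κ * l0norm θs * log d := by positivity
    linarith [mul_le_mul_of_nonneg_left hcone.le hρ]

end Compatibility

section FarPoints

variable {c K κ : ℝ} {S : ℕ} {u : Fin d → ℝ}

lemma mul_rho_mul_sqrt_le (hn : 0 < n) (hκ : 0 < κ)
    (hu : c * maxNorm X / κ * √(S * log d / n) < l2norm u) :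
    c / 4 * rho X * √S ≤ κ * (n * l2norm u) := by
  have : (0 : ℝ) < n := Nat.cast_pos.2 hn
  have hsqrt : √(S * log d / n) = √S * √(n * log d) / n := by
    rw [← sqrt_mul (Nat.cast_nonneg S), eq_div_iff this.ne', ← sqrt_sq this.le,
      ← sqrt_mul' _ (sq_nonneg _), sqrt_sq this.le]
    congr 1
    field_simp
  calc c / 4 * rho X * √S = κ * (n * (c * maxNorm X / κ * √(S * log d / n))) := by
        rw [hsqrt, rho]
        field_simp
    _ ≤ κ * (n * l2norm u) := by gcongr

lemma mul_sqrt_mul_log_le (hM : 0 < maxNorm X) (hκ : 0 < κ) (hκM : κ ≤ maxNorm X ^ 2)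
    (hu : c * maxNorm X / κ * √(S * log d / n) < l2norm u) :
    4 * c * √S * log d ≤ rho X * l2norm u := by
  have hn := pos_of_maxNorm_pos hM
  have : (0 : ℝ) < n := Nat.cast_pos.2 hn
  have hu0 := l2norm_nonneg u
  have hρ := rho_nonneg (X := X)
  refine le_of_mul_le_mul_left ?_ (show 0 < maxNorm X ^ 2 * n by positivity)
  calc maxNorm X ^ 2 * n * (4 * c * √S * log d) = rho X * (c / 4 * rho X * √S) := by
        rw [show rho X * (c / 4 * rho X * √S) = c / 4 * √S * rho X ^ 2 by ring, rho_sq]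
        ring
    _ ≤ rho X * (maxNorm X ^ 2 * (n * l2norm u)) := by
        gcongr rho X * ?_
        exact (mul_rho_mul_sqrt_le hn hκ hu).trans (by gcongr)
    _ = maxNorm X ^ 2 * n * (rho X * l2norm u) := by ring

lemma mul_rho_mul_sqrt_le_remainder (hn : 0 < n) (hκ : 0 < kappaSparse X θs S)
    (hS : l0norm u ≤ S) (hl1 : maxNorm X * l1norm u ≤ 3 + K)
    (hu : 11 * (5 + K) * maxNorm X / kappaSparse X θs S * √(S * log d / n) < l2norm u) :
    11 / 4 * rho X * (√S * l2norm u) ≤ remainder X θs u := by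
  have hu0 := l2norm_nonneg u
  have hρ := rho_nonneg (X := X)
  have hl1' := mul_nonneg (maxNorm_nonneg (X := X)) (l1norm_nonneg u)
  refine le_trans ?_ (fisher_div_le_remainder u)
  rw [le_div_iff₀ (by positivity)]
  calc 11 / 4 * rho X * (√S * l2norm u) * (2 + maxNorm X * l1norm u)
      ≤ 11 / 4 * rho X * (√S * l2norm u) * (2 + (3 + K)) := by gcongr
    _ = 11 * (5 + K) / 4 * rho X * √S * l2norm u := by ring
    _ ≤ kappaSparse X θs S * (n * l2norm u) * l2norm u := by
        gcongr ?_ * l2norm u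
        exact mul_rho_mul_sqrt_le hn hκ hu
    _ = kappaSparse X θs S * (n * l2norm u ^ 2) := by ring
    _ ≤ fisher X θs u := kappaSparse_mul_le_fisher hS

lemma SampleSizeBound.mul_log_le_rho (h : SampleSizeBound X θs κ) (hM : 0 < maxNorm X)
    (hκ : 0 < κ) (hℓ : 0 < log d) :
    448 * maxNorm X ^ 2 / κ * l0norm θs * log d * maxNorm X ≤ rho X := by
  have hρ := rho_pos hM hℓ
  have : (0 : ℝ) < n := Nat.cast_pos.2 (pos_of_maxNorm_pos hM)
  refine le_of_mul_le_mul_left ?_ (show 0 < κ * n * rho X by positivity)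
  calc κ * n * rho X * (448 * maxNorm X ^ 2 / κ * l0norm θs * log d * maxNorm X)
      = rho X ^ 2 * (28 * maxNorm X * rho X * l0norm θs) := by
        rw [rho_sq]
        field_simp
        ring
    _ ≤ rho X ^ 2 * (κ * n) := by
        gcongr rho X ^ 2 * ?_
        exact h.mul_rho_le hκ
    _ = κ * n * rho X * rho X := by ring

variable {θ : Fin d → ℝ}

lemma ScoreBounded.logRatio_le_of_l1norm_le (hz : ScoreBounded X (rho X) θs z) (hK : 0 ≤ K)
    (hℓ : 0 < log d) (hκ : 0 < kappaSparse X θs S) (hS : l0norm θs ≤ S) (hS1 : 1 ≤ S)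
    (hdim : l0norm (θ - θs) ≤ S) (hl1 : maxNorm X * l1norm (θ - θs) ≤ 3 + K)
    (hfar : 11 * (5 + K) * maxNorm X / kappaSparse X θs S * √(S * log d / n) < l2norm (θ - θs)) :
    logRatio X (rho X) θs z θ ≤
      -(K * (1 + l0norm θs) * log d) - 1 / 8 * rho X * l1norm (θ - θs) := by
  have hM := maxNorm_pos_of_kappaSparse_pos hκ
  have hρ := rho_nonneg (X := X)
  have hrem := mul_rho_mul_sqrt_le_remainder (pos_of_maxNorm_pos hM) hκ hdim hl1 hfar
  have hscore : logRatio X (rho X) θs z θ ≤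
      3 / 2 * (rho X * l1norm (θ - θs)) - remainder X θs (θ - θs) := by
    refine (hz.logRatio_le hρ θ).trans ?_
    rw [l1norm_eq_sum_add_sum_compl (θ - θs) (supp θs)]
    have hcompl : 0 ≤ rho X * ∑ j ∈ (supp θs)ᶜ, |(θ - θs) j| :=
      mul_nonneg hρ (Finset.sum_nonneg fun _ _ => abs_nonneg _)
    linarith
  have hnorms : rho X * l1norm (θ - θs) ≤ rho X * (√S * l2norm (θ - θs)) := by
    gcongr
    exact l1norm_le_sqrt_mul_l2norm hdim
  have hgain : 4 * (11 * (5 + K)) * S * log d ≤ rho X * (√S * l2norm (θ - θs)) := by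
    calc 4 * (11 * (5 + K)) * S * log d = √S * (4 * (11 * (5 + K)) * √S * log d) := by
          rw [mul_left_comm, ← mul_assoc, ← mul_assoc √S]
          nth_rewrite 1 [← mul_self_sqrt (Nat.cast_nonneg (α := ℝ) S)]
          ring
      _ ≤ √S * (rho X * l2norm (θ - θs)) := by
          gcongr √S * ?_
          exact mul_sqrt_mul_log_le hM hκ kappaSparse_le_maxNorm_sq hfar
      _ = rho X * (√S * l2norm (θ - θs)) := by ring
  have hsize : K * (1 + l0norm θs) * log d ≤ 4 * (11 * (5 + K)) * S * log d := by
    have hS' : (1 + l0norm θs : ℝ) ≤ 2 * S := by exact_mod_cast (by omega : 1 + l0norm θs ≤ 2 * S)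
    have hKS : 0 ≤ K * S := by positivity
    gcongr ?_ * log d
    linarith [mul_le_mul_of_nonneg_left hS' hK, (Nat.cast_nonneg S : (0 : ℝ) ≤ S)]
  have hl1 := mul_nonneg hρ (l1norm_nonneg (θ - θs))
  linarith

lemma ScoreBounded.logRatio_le_of_le_l1norm (hz : ScoreBounded X (rho X) θs z) (hK : 0 ≤ K)
    (hℓ : 0 < log d) (hcompat : IsCompatibilityConst X θs κ) (hκ : 0 < κ)
    (hκS : κ ≤ kappaSparse X θs S) (hsize : SampleSizeBound X θs κ) (hS1 : 1 ≤ S)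
    (hl1 : 3 + K ≤ maxNorm X * l1norm (θ - θs))
    (hfar : 11 * (5 + K) * maxNorm X / kappaSparse X θs S * √(S * log d / n) < l2norm (θ - θs)) :
    logRatio X (rho X) θs z θ ≤
      -(K * (1 + l0norm θs) * log d) - 1 / 8 * rho X * l1norm (θ - θs) := by
  have hκS0 := hκ.trans_le hκS
  have hM := maxNorm_pos_of_kappaSparse_pos hκS0
  have hκM : κ ≤ maxNorm X ^ 2 := hκS.trans kappaSparse_le_maxNorm_sq
  have hu := l1norm_nonneg (θ - θs)
  have hpenalty := hz.logRatio_le_sub_l1norm hcompat hκ (pos_of_maxNorm_pos hM) hsize θ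
  set B := maxNorm X ^ 2 / κ * l0norm θs * log d with hB
  have hB0 : 0 ≤ B := by positivity
  have hBs : l0norm θs * log d ≤ B := by
    rw [hB, mul_assoc]
    exact le_mul_of_one_le_left (by positivity) ((one_le_div hκ).2 hκM)
  have hBρ : 28 * (3 + K) * B ≤ 1 / 16 * (rho X * l1norm (θ - θs)) := by
    calc 28 * (3 + K) * B ≤ 28 * (maxNorm X * l1norm (θ - θs)) * B := by gcongr
      _ = 1 / 16 * ((448 * maxNorm X ^ 2 / κ * l0norm θs * log d * maxNorm X)
            * l1norm (θ - θs)) := by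
          rw [hB]
          ring
      _ ≤ 1 / 16 * (rho X * l1norm (θ - θs)) := by
          gcongr
          exact hsize.mul_log_le_rho hM hκ hℓ
  have hKρ : K * log d ≤ 1 / 16 * (rho X * l1norm (θ - θs)) := by
    have hfar' := mul_sqrt_mul_log_le hM hκS0 kappaSparse_le_maxNorm_sq hfar
    have hS : 4 * (11 * (5 + K)) * 1 * log d ≤ 4 * (11 * (5 + K)) * √S * log d := by
      gcongr
      exact one_le_sqrt.2 (Nat.one_le_cast.2 hS1)
    have hnorms : rho X * l2norm (θ - θs) ≤ rho X * l1norm (θ - θs) :=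
      mul_le_mul_of_nonneg_left (l2norm_le_l1norm _) rho_nonneg
    linarith [mul_nonneg hK hℓ.le]
  have hpenalty' : logRatio X (rho X) θs z θ ≤
      64 * B - 1 / 4 * (rho X * l1norm (θ - θs)) := by
    refine hpenalty.trans_eq ?_
    rw [hB]
    ring
  linarith [mul_le_mul_of_nonneg_left hBs hK, mul_nonneg hK hB0]

lemma ScoreBounded.logRatio_le_of_far (hz : ScoreBounded X (rho X) θs z) (hK : 0 ≤ K)
    (hℓ : 0 < log d) (hcompat : IsCompatibilityConst X θs κ) (hκ : 0 < κ)
    (hκS : κ ≤ kappaSparse X θs S) (hsize : SampleSizeBound X θs κ) (hS : l0norm θs ≤ S)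
    (hS1 : 1 ≤ S) (hdim : l0norm (θ - θs) ≤ S)
    (hfar : 11 * (5 + K) * maxNorm X / kappaSparse X θs S * √(S * log d / n) < l2norm (θ - θs)) :
    logRatio X (rho X) θs z θ ≤
      -(K * (1 + l0norm θs) * log d) - 1 / 8 * rho X * l1norm (θ - θs) := by
  rcases le_total (maxNorm X * l1norm (θ - θs)) (3 + K) with hl1 | hl1
  · exact hz.logRatio_le_of_l1norm_le hK hℓ (hκ.trans_le hκS) hS hS1 hdim hl1 hfar
  · exact hz.logRatio_le_of_le_l1norm hK hℓ hcompat hκ hκS hsize hS1 hl1 hfar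

end FarPoints

section Concentration

variable {Ω : Type*} [MeasurableSpace Ω] {P : Measure Ω}

section Hoeffding

variable [IsProbabilityMeasure P] {ι : Type*} [Fintype ι] {Y : ι → Ω → ℝ} {c ε : ℝ}

lemma measureReal_sum_ge_le (hmeas : ∀ i, Measurable (Y i)) (hindep : iIndepFun Y P)
    (hbound : ∀ i ω, |Y i ω| ≤ c) (hmean : ∀ i, ∫ ω, Y i ω ∂P = 0) (hε : 0 ≤ ε) :
    P.real {ω | ε ≤ ∑ i, Y i ω} ≤ exp (-ε ^ 2 / (2 * (Fintype.card ι * c ^ 2))) := by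
  have hsub (i : ι) (_ : i ∈ Finset.univ) :
      HasSubgaussianMGF (Y i) ((‖c - -c‖₊ / 2) ^ 2) P :=
    hasSubgaussianMGF_of_mem_Icc_of_integral_eq_zero (hmeas i).aemeasurable
      (ae_of_all _ fun ω => abs_le.1 (hbound i ω)) (hmean i)
  have hvar : ((‖c - -c‖₊ / 2 : NNReal) : ℝ) ^ 2 = c ^ 2 := by
    rw [NNReal.coe_div, coe_nnnorm, sub_neg_eq_add, div_pow, Real.norm_eq_abs, sq_abs,
      NNReal.coe_ofNat]
    ring
  refine (HasSubgaussianMGF.measure_sum_ge_le_of_iIndepFun hindep hsub hε).trans_eq ?_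
  rw [Finset.sum_const, nsmul_eq_mul, NNReal.coe_mul, NNReal.coe_pow, hvar, Finset.card_univ,
    NNReal.coe_natCast]

lemma measureReal_abs_sum_ge_le (hmeas : ∀ i, Measurable (Y i)) (hindep : iIndepFun Y P)
    (hbound : ∀ i ω, |Y i ω| ≤ c) (hmean : ∀ i, ∫ ω, Y i ω ∂P = 0) (hε : 0 ≤ ε) :
    P.real {ω | ε ≤ |∑ i, Y i ω|} ≤ 2 * exp (-ε ^ 2 / (2 * (Fintype.card ι * c ^ 2))) := by
  have hupper := measureReal_sum_ge_le hmeas hindep hbound hmean hε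
  have hlower := measureReal_sum_ge_le (Y := fun i ω => -Y i ω) (fun i => (hmeas i).neg)
    (hindep.comp (fun _ y => -y) fun _ => measurable_neg) (by simpa only [abs_neg] using hbound)
    (by simpa only [integral_neg, neg_eq_zero] using hmean) hε
  have hunion : {ω | ε ≤ |∑ i, Y i ω|} = {ω | ε ≤ ∑ i, Y i ω} ∪ {ω | ε ≤ ∑ i, -Y i ω} := by
    ext ω
    simp only [Set.mem_ofPred_eq, Set.mem_union, le_abs, Finset.sum_neg_distrib]
  rw [hunion]
  linarith [measureReal_union_le (μ := P) {ω | ε ≤ ∑ i, Y i ω} {ω | ε ≤ ∑ i, -Y i ω}]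

end Hoeffding

namespace LogisticModel

variable {Z : Fin n → Ω → ℝ}

lemma integral_eq_sigmoid (hZ : LogisticModel P X θs Z) (i : Fin n) :
    ∫ ω, Z i ω ∂P = sigmoid (X i ⬝ᵥ θs) := by
  have hind : Z i = ({ω | Z i ω = 1} : Set Ω).indicator 1 := by
    funext ω
    rcases hZ.binary i ω with h | h <;> simp [Set.indicator, h]
  have hmeas : MeasurableSet {ω | Z i ω = 1} := hZ.measurable i (measurableSet_singleton 1)
  rw [hind, integral_indicator_one hmeas, Measure.real, hZ.prob_one,
    ENNReal.toReal_ofReal (by positivity), sigmoid_def, exp_neg]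
  field_simp
  ring

lemma abs_sub_sigmoid_le_one (hZ : LogisticModel P X θs Z) (i : Fin n) (ω : Ω) :
    |Z i ω - sigmoid (X i ⬝ᵥ θs)| ≤ 1 := by
  have h0 := sigmoid_nonneg (X i ⬝ᵥ θs)
  have h1 := sigmoid_le_one (X i ⬝ᵥ θs)
  rcases hZ.binary i ω with h | h <;> rw [h, abs_le] <;> constructor <;> linarith

lemma measurableSet_not_scoreBounded (hZ : LogisticModel P X θs Z) (ρ : ℝ) :
    MeasurableSet {ω | ¬ ScoreBounded X ρ θs fun i => Z i ω} := by
  have hscore (j : Fin d) : Measurable fun ω => |score X θs (fun i => Z i ω) j| := by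
    have := hZ.measurable
    unfold score
    fun_prop
  have hunion : {ω | ¬ ScoreBounded X ρ θs fun i => Z i ω} =
      ⋃ j, {ω | ρ / 2 < |score X θs (fun i => Z i ω) j|} := by
    ext ω
    simp [ScoreBounded]
  rw [hunion]
  exact MeasurableSet.iUnion fun j => measurableSet_lt measurable_const (hscore j)

variable [IsProbabilityMeasure P]

lemma integral_sub_sigmoid (hZ : LogisticModel P X θs Z) (i : Fin n) :
    ∫ ω, (Z i ω - sigmoid (X i ⬝ᵥ θs)) ∂P = 0 := by
  have hint : Integrable (Z i) P :=
    Integrable.of_mem_Icc 0 1 (hZ.measurable i).aemeasurable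
      (ae_of_all _ fun ω => by rcases hZ.binary i ω with h | h <;> simp [h])
  rw [integral_sub hint (integrable_const _), hZ.integral_eq_sigmoid]
  simp

lemma measureReal_abs_score_ge_le (hZ : LogisticModel P X θs Z) (hM : 0 < maxNorm X) (hd : 0 < d)
    (j : Fin d) :
    P.real {ω | rho X / 2 ≤ |score X θs (fun i => Z i ω) j|} ≤ 2 / (d : ℝ) ^ 2 := by
  have hmeas (i : Fin n) : Measurable fun ω => X i j * (Z i ω - sigmoid (X i ⬝ᵥ θs)) := by
    have := hZ.measurable i
    fun_prop
  have hindep : iIndepFun (fun i ω => X i j * (Z i ω - sigmoid (X i ⬝ᵥ θs))) P :=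
    hZ.indep.comp (fun i x => X i j * (x - sigmoid (X i ⬝ᵥ θs))) fun i => by fun_prop
  have hbound (i : Fin n) (ω : Ω) :
      |X i j * (Z i ω - sigmoid (X i ⬝ᵥ θs))| ≤ maxNorm X := by
    rw [abs_mul]
    exact (mul_le_of_le_one_right (abs_nonneg _) (hZ.abs_sub_sigmoid_le_one i ω)).trans
      (abs_le_maxNorm i j)
  have hmean (i : Fin n) : ∫ ω, X i j * (Z i ω - sigmoid (X i ⬝ᵥ θs)) ∂P = 0 := by
    rw [integral_const_mul, hZ.integral_sub_sigmoid, mul_zero]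
  have hρ : 0 ≤ rho X / 2 := div_nonneg rho_nonneg zero_le_two
  refine (measureReal_abs_sum_ge_le hmeas hindep hbound hmean hρ).trans_eq ?_
  have hn : (n : ℝ) ≠ 0 := Nat.cast_ne_zero.2 (pos_of_maxNorm_pos hM).ne'
  have hexponent : -(rho X / 2) ^ 2 / (2 * (n * maxNorm X ^ 2)) = -log ((d : ℝ) ^ 2) := by
    rw [div_pow, rho_sq, log_pow]
    push_cast
    field_simp
    ring
  rw [Fintype.card_fin, hexponent, exp_neg, exp_log (by positivity), div_eq_mul_inv]

lemma measure_not_scoreBounded_le (hZ : LogisticModel P X θs Z) (hM : 0 < maxNorm X)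
    (hd : 0 < d) :
    P {ω | ¬ ScoreBounded X (rho X) θs fun i => Z i ω} ≤ 2 / (d : ℝ≥0∞) := by
  have hd' : (0 : ℝ) < d := Nat.cast_pos.2 hd
  have hsub : {ω | ¬ ScoreBounded X (rho X) θs fun i => Z i ω} ⊆
      ⋃ j, {ω | rho X / 2 ≤ |score X θs (fun i => Z i ω) j|} := fun ω hω => by
    obtain ⟨j, hj⟩ := not_forall.1 hω
    exact Set.mem_iUnion.2 ⟨j, (not_le.1 hj).le⟩
  calc P {ω | ¬ ScoreBounded X (rho X) θs fun i => Z i ω}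
      ≤ P (⋃ j, {ω | rho X / 2 ≤ |score X θs (fun i => Z i ω) j|}) := measure_mono hsub
    _ ≤ ∑ j : Fin d, P {ω | rho X / 2 ≤ |score X θs (fun i => Z i ω) j|} :=
        measure_iUnion_fintype_le _ _
    _ ≤ ∑ j : Fin d, ENNReal.ofReal (2 / (d : ℝ) ^ 2) := by
        gcongr with j
        rw [← ofReal_measureReal]
        exact ENNReal.ofReal_le_ofReal (hZ.measureReal_abs_score_ge_le hM hd j)
    _ = ENNReal.ofReal (2 / d) := by
        rw [Finset.sum_const, Finset.card_univ, Fintype.card_fin, nsmul_eq_mul,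
          ← ENNReal.ofReal_natCast, ← ENNReal.ofReal_mul hd'.le]
        congr 1
        field_simp
    _ = 2 / (d : ℝ≥0∞) := by
        rw [ENNReal.ofReal_div_of_pos hd', ENNReal.ofReal_ofNat, ENNReal.ofReal_natCast]

lemma lintegral_posterior_le (hZ : LogisticModel P X θs Z) (hM : 0 < maxNorm X) (hd : 0 < d)
    {ρ : ℝ} {w : Finset (Fin d) → ℝ} {B : Set (Fin d → ℝ)} {x : ℝ≥0∞}
    (h : ∀ z, ScoreBounded X (rho X) θs z → posterior X ρ w z B ≤ x) :
    ∫⁻ ω, posterior X ρ w (fun i => Z i ω) B ∂P ≤ x + 2 / (d : ℝ≥0∞) := by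
  refine (lintegral_le_add_measure (hZ.measurableSet_not_scoreBounded (rho X))
    (fun _ => posterior_le_one) fun ω hω => h _ (not_not.1 hω)).trans ?_
  gcongr
  exact hZ.measure_not_scoreBounded_le hM hd

end LogisticModel

end Concentration

section SizePrior

lemma sum_half_pow_sub_le_two {T : Finset ℕ} {t : ℕ} (hT : ∀ k ∈ T, t ≤ k) :
    ∑ k ∈ T, (1 / 2 : ℝ) ^ (k - t) ≤ 2 := by
  have hinj : Set.InjOn (fun k => k - t) T := fun i hi j hj hij => by
    have := hT i hi
    have := hT j hj
    grind
  rw [← Finset.sum_image (f := fun m => (1 / 2 : ℝ) ^ m) hinj]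
  exact (summable_geometric_two.sum_le_tsum _ fun m _ => by positivity).trans_eq
    tsum_geometric_two

lemma sum_filter_le_of_succ_le {a : ℕ → ℝ} {N t : ℕ} {r x : ℝ} (hr : 0 < r) (hr1 : r ≤ 1)
    (ha : ∀ k < N, a (k + 1) ≤ r / 2 * a k) (hat : 0 ≤ a t) (hx : t ≤ x) :
    ∑ k ∈ Finset.range (N + 1) with (x ≤ ((k : ℕ) : ℝ)), a k ≤ 2 * a t * r ^ (x - t) := by
  have hle {k : ℕ} (hk : k ∈ (Finset.range (N + 1)).filter fun k : ℕ => x ≤ k) : t ≤ k :=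
    Nat.cast_le.1 (hx.trans (Finset.mem_filter.1 hk).2)
  have hterm {k : ℕ} (hk : k ∈ (Finset.range (N + 1)).filter fun k : ℕ => x ≤ k) :
      a k ≤ a t * r ^ (x - t) * (1 / 2) ^ (k - t) := by
    obtain ⟨m, rfl⟩ := Nat.exists_eq_add_of_le (hle hk)
    obtain ⟨hkN, hkx⟩ := Finset.mem_filter.1 hk
    rw [Finset.mem_range] at hkN
    have hpow : r ^ m ≤ r ^ (x - t) := by
      rw [← rpow_natCast]
      refine rpow_le_rpow_of_exponent_ge hr hr1 ?_
      push_cast at hkx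
      linarith
    calc a (t + m) ≤ (r / 2) ^ m * a t :=
          le_geom (u := fun i => a (t + i)) (by positivity) m fun i hi => ha (t + i) (by omega)
      _ = a t * r ^ m * (1 / 2) ^ (t + m - t) := by
          rw [div_pow, Nat.add_sub_cancel_left, one_div, inv_pow]
          ring
      _ ≤ a t * r ^ (x - t) * (1 / 2) ^ (t + m - t) := by gcongr
  calc ∑ k ∈ Finset.range (N + 1) with (x ≤ ((k : ℕ) : ℝ)), a k
      ≤ ∑ k ∈ Finset.range (N + 1) with (x ≤ ((k : ℕ) : ℝ)),
          a t * r ^ (x - t) * (1 / 2) ^ (k - t) := Finset.sum_le_sum fun k hk => hterm hk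
    _ ≤ a t * r ^ (x - t) * 2 := by
        rw [← Finset.mul_sum]
        gcongr
        exact sum_half_pow_sub_le_two fun k hk => hle hk
    _ = 2 * a t * r ^ (x - t) := by ring

/-- The law of the model size, up to normalization: positive weights `h` on `{0, …, d}` whose
successive ratios satisfy the bounds of (H2). -/
structure IsSizePrior (d : ℕ) (c₁ c₂ c₃ c₄ : ℝ) (h : ℕ → ℝ) : Prop where
  pos : ∀ k ≤ d, 0 < h k
  le_succ : ∀ k < d, c₁ / (d : ℝ) ^ c₃ * h k ≤ h (k + 1)
  succ_le : ∀ k < d, h (k + 1) ≤ c₂ / (d : ℝ) ^ c₄ * h k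

variable {c₁ c₂ c₃ c₄ : ℝ} {w : Finset (Fin d) → ℝ} {h : ℕ → ℝ}

lemma SparsePrior.exists_isSizePrior (hw : SparsePrior d c₁ c₂ c₃ c₄ w) (hd : 0 < d)
    (hc₁ : 0 < c₁) (hc₂ : 0 < c₂) :
    ∃ h, IsSizePrior d c₁ c₂ c₃ c₄ h ∧
      ∀ δ : Finset (Fin d), w δ = h δ.card / (d.choose δ.card : ℝ) := by
  obtain ⟨h, hnonneg, hsum, hratio, hwh⟩ := hw
  have hlower (k : ℕ) (hk : k < d) := (hratio (k + 1) k.succ_pos hk).1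
  have hupper (k : ℕ) (hk : k < d) := (hratio (k + 1) k.succ_pos hk).2
  simp only [Nat.add_sub_cancel] at hlower hupper
  have hzero : 0 < h 0 := by
    refine (hnonneg 0 d.zero_le).lt_of_ne' fun h0 => ?_
    have hall : ∑ k ∈ Finset.range (d + 1), h k ≤ 0 := Finset.sum_nonpos fun k hk => by
      have := le_geom (u := h) (c := c₂ / (d : ℝ) ^ c₄) (by positivity) k fun i hi =>
        hupper i (by rw [Finset.mem_range] at hk; omega)
      rwa [h0, mul_zero] at this
    linarith
  refine ⟨h, ⟨fun k hk => ?_, hlower, hupper⟩, hwh⟩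
  exact (mul_pos (pow_pos (by positivity) k) hzero).trans_le
    (geom_le (c := c₁ / (d : ℝ) ^ c₃) (by positivity) k fun i hi => hlower i (by omega))

lemma sum_filter_card_mul_pow {p : ℕ → Prop} [DecidablePred p]
    (hw : ∀ δ : Finset (Fin d), w δ = h δ.card / (d.choose δ.card : ℝ)) (b : ℝ) :
    ∑ δ with p δ.card, w δ * b ^ δ.card = ∑ k ∈ Finset.range (d + 1) with p k, h k * b ^ k := by
  simp only [hw, Finset.sum_filter]
  rw [← Finset.powerset_univ, Finset.sum_powerset_apply_card
    (fun k => if p k then h k / (d.choose k : ℝ) * b ^ k else 0), Finset.card_univ,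
    Fintype.card_fin]
  refine Finset.sum_congr rfl fun k hk => ?_
  have hchoose : (d.choose k : ℝ) ≠ 0 :=
    Nat.cast_ne_zero.2 (Nat.choose_pos (Finset.mem_range_succ_iff.1 hk)).ne'
  split_ifs
  · rw [nsmul_eq_mul]
    field_simp
  · exact smul_zero _

namespace IsSizePrior

lemma zero_le_pow_mul (hh : IsSizePrior d c₁ c₂ c₃ c₄ h) (hd : 0 < d) (hc₁ : 0 < c₁) {s : ℕ}
    (hs : s ≤ d) : h 0 ≤ ((d : ℝ) ^ c₃ / c₁) ^ s * h s := by
  have hgeom := geom_le (c := c₁ / (d : ℝ) ^ c₃) (by positivity) s fun k hk =>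
    hh.le_succ k (hk.trans_le hs)
  rwa [← inv_div, inv_pow, ← inv_mul_le_iff₀ (by positivity), inv_inv]

lemma sum_mul_eight_pow_le (hh : IsSizePrior d c₁ c₂ c₃ c₄ h) (hd : 0 < d) (hc₄ : 0 < c₄)
    (hdc : 16 * c₂ ≤ (d : ℝ) ^ (c₄ / 2)) {t : ℕ} (ht : t ≤ d) {x : ℝ} (hx : t ≤ x) :
    ∑ k ∈ Finset.range (d + 1) with (x ≤ ((k : ℕ) : ℝ)), h k * 8 ^ k ≤
      2 * (h t * 8 ^ t) * exp (-(c₄ / 2 * log d * (x - t))) := by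
  have hd' : (0 : ℝ) < d := Nat.cast_pos.2 hd
  set r := (d : ℝ) ^ (-(c₄ / 2))
  have hratio : 8 * (c₂ / (d : ℝ) ^ c₄) ≤ r / 2 := by
    have hsplit : (d : ℝ) ^ c₄ = (d : ℝ) ^ (c₄ / 2) * (d : ℝ) ^ (c₄ / 2) := by
      rw [← rpow_add hd', add_halves]
    have hr : r = ((d : ℝ) ^ (c₄ / 2))⁻¹ := rpow_neg hd'.le _
    rw [hsplit, hr]
    field_simp
    linarith
  have hsucc (k : ℕ) (hk : k < d) : h (k + 1) * 8 ^ (k + 1) ≤ r / 2 * (h k * 8 ^ k) := by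
    have hk0 := hh.pos k hk.le
    calc h (k + 1) * 8 ^ (k + 1) ≤ c₂ / (d : ℝ) ^ c₄ * h k * 8 ^ (k + 1) := by
          gcongr
          exact hh.succ_le k hk
      _ = 8 * (c₂ / (d : ℝ) ^ c₄) * (h k * 8 ^ k) := by ring
      _ ≤ r / 2 * (h k * 8 ^ k) := by gcongr
  have hr1 : r ≤ 1 := rpow_le_one_of_one_le_of_nonpos (Nat.one_le_cast.2 hd) (by linarith)
  refine (sum_filter_le_of_succ_le (a := fun k => h k * 8 ^ k) (by positivity) hr1 hsucc
    (mul_nonneg (hh.pos t ht).le (by positivity)) hx).trans_eq ?_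
  rw [← rpow_mul hd'.le, rpow_def_of_pos hd']
  ring_nf

end IsSizePrior

end SizePrior

variable {c₁ c₂ c₃ c₄ : ℝ}

section SparsityLevel

lemma kappaBar_nonneg (s : ℕ) : 0 ≤ kappaBar X s := by
  refine Real.sSup_nonneg ?_
  rintro _ ⟨u, -, rfl⟩
  refine div_nonneg ?_ (by positivity)
  rw [← Matrix.mulVec_mulVec, Matrix.dotProduct_mulVec, Matrix.vecMul_transpose]
  exact Finset.sum_nonneg fun i _ => mul_self_nonneg _

lemma log_four_mul_exp_one : log (4 * exp 1) = log 4 + 1 := by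
  rw [log_mul (by norm_num) (exp_pos 1).ne', log_exp]

lemma l0norm_add_le_zeta (hc₄ : 0 < c₄) (hk : 0 ≤ kappa X θs) :
    l0norm θs + 2 / c₄ ≤ zeta c₄ X θs := by
  have : 0 ≤ (kappa X θs).toReal := EReal.toReal_nonneg hk
  have hκb := kappaBar_nonneg (X := X) (l0norm θs)
  have hlog : 0 ≤ log (4 * exp 1) := by
    rw [log_four_mul_exp_one]
    positivity
  unfold zeta
  exact le_add_of_nonneg_right (by positivity)

lemma l0norm_lt_zeta (hc₄ : 0 < c₄) (hk : 0 ≤ kappa X θs) : l0norm θs < zeta c₄ X θs :=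
  (lt_add_of_pos_right _ (by positivity)).trans_le (l0norm_add_le_zeta hc₄ hk)

lemma log_add_le_mul_zeta_sub (hc₄ : 0 < c₄) (hℓ : 0 < log d) :
    log d + (1 + 64 * maxNorm X ^ 2 / (kappa X θs).toReal) * l0norm θs * log d
      + log (4 * exp 1) * l0norm θs ≤ c₄ / 2 * log d * (zeta c₄ X θs - l0norm θs) := by
  have hκb := kappaBar_nonneg (X := X) (l0norm θs)
  set p := 64 * maxNorm X ^ 2 / (kappa X θs).toReal with hp
  set q := kappaBar X (l0norm θs) / (64 * maxNorm X ^ 2 * log d ^ 2) with hq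
  have hq0 : 0 ≤ log d * q * l0norm θs := by positivity
  have hzeta : c₄ / 2 * log d * (zeta c₄ X θs - l0norm θs) =
      log d + (1 + p) * l0norm θs * log d + log (4 * exp 1) * l0norm θs
        + log d * q * l0norm θs := by
    rw [zeta, ← hp, ← hq]
    field_simp
    ring
  linarith

lemma l0norm_le_sBar (hc₄ : 0 < c₄) (hk : 0 ≤ kappa X θs) : l0norm θs ≤ sBar c₄ X θs := by
  have hζ := l0norm_lt_zeta hc₄ hk
  refine Nat.cast_le.1 (le_trans ?_ (Nat.le_ceil (l0norm θs + zeta c₄ X θs : ℝ)))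
  linarith [(l0norm θs).cast_nonneg (α := ℝ)]

lemma one_le_sBar (hc₄ : 0 < c₄) (hk : 0 ≤ kappa X θs) : 1 ≤ sBar c₄ X θs := by
  have hζ := l0norm_lt_zeta hc₄ hk
  exact Nat.ceil_pos.2 (by linarith [(l0norm θs).cast_nonneg (α := ℝ)])

lemma l0norm_sub_le_sBar {θ : Fin d → ℝ} (hθ : l0norm θ < zeta c₄ X θs) :
    l0norm (θ - θs) ≤ sBar c₄ X θs := by
  refine Nat.cast_le.1 (le_trans ?_ (Nat.le_ceil (l0norm θs + zeta c₄ X θs : ℝ)))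
  have hsub : (l0norm (θ - θs) : ℝ) ≤ l0norm θ + l0norm θs := mod_cast l0norm_sub_le θ θs
  linarith

lemma toReal_kappaMin_pos (hk : 0 < kappaMin c₄ X θs) : 0 < (kappaMin c₄ X θs).toReal :=
  EReal.toReal_pos hk (ne_top_of_le_ne_top (EReal.coe_ne_top _) (min_le_right _ _))

lemma toReal_kappaMin_le_kappaSparse (hk : 0 < kappaMin c₄ X θs) :
    (kappaMin c₄ X θs).toReal ≤ kappaSparse X θs (sBar c₄ X θs) :=
  EReal.toReal_le_toReal (min_le_right _ _) (ne_bot_of_gt hk) (EReal.coe_ne_top _)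

lemma kappa_pos_of_kappaMin_pos (hk : 0 < kappaMin c₄ X θs) : 0 < kappa X θs :=
  hk.trans_le (min_le_left _ _)

lemma maxNorm_pos_of_kappaMin_pos (hk : 0 < kappaMin c₄ X θs) : 0 < maxNorm X :=
  maxNorm_pos_of_kappaSparse_pos
    ((toReal_kappaMin_pos hk).trans_le (toReal_kappaMin_le_kappaSparse hk))

lemma SampleSizeBound.mono {κ κ' : ℝ} (hsize : SampleSizeBound X θs κ) (hκ : 0 < κ)
    (h : κ ≤ κ') : SampleSizeBound X θs κ' := by
  have hκ' := hκ.trans_le h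
  refine le_trans ?_ hsize
  gcongr

lemma ScoreBounded.logRatio_le_sub_l1norm_of_kappaMin_pos (hz : ScoreBounded X (rho X) θs z)
    (hk : 0 < kappaMin c₄ X θs) (hsize : SampleSizeBound X θs (kappaMin c₄ X θs).toReal)
    (θ : Fin d → ℝ) :
    logRatio X (rho X) θs z θ ≤ 64 * maxNorm X ^ 2 / (kappa X θs).toReal * l0norm θs * log d
      - 1 / 4 * rho X * l1norm (θ - θs) := by
  have hn := pos_of_maxNorm_pos (maxNorm_pos_of_kappaMin_pos hk)
  have hκ := toReal_kappaMin_pos hk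
  rcases eq_or_ne (l0norm θs) 0 with hs | hs
  · have h := hz.logRatio_le_sub_l1norm (isCompatibilityConst_toReal hk (min_le_left _ _)) hκ hn
      hsize θ
    simpa only [hs, Nat.cast_zero, mul_zero, zero_mul] using h
  · have hle : (kappaMin c₄ X θs).toReal ≤ (kappa X θs).toReal :=
      EReal.toReal_le_toReal (min_le_left _ _) (ne_bot_of_gt hk) (kappa_ne_top hs)
    exact hz.logRatio_le_sub_l1norm
      (isCompatibilityConst_toReal (kappa_pos_of_kappaMin_pos hk) le_rfl) (hκ.trans_le hle) hn
      (hsize.mono hκ hle) θ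

end SparsityLevel

section LargeDimension

/-- The dimension `d` is large relative to the constants of (H2). The first bound makes the odds
`d ^ c₃ / c₁` of dropping a coordinate at most `d ^ (1 + c₃) / e`, the second one lets `h k * 8 ^ k`
decrease geometrically. -/
structure IsLargeDim (c₁ c₂ c₄ : ℝ) (d : ℕ) : Prop where
  two_le : 2 ≤ d
  exp_one_le : exp 1 ≤ c₁ * d
  mul_le_rpow : 16 * c₂ ≤ (d : ℝ) ^ (c₄ / 2)

lemma eventually_isLargeDim (hc₁ : 0 < c₁) (hc₄ : 0 < c₄) :
    ∀ᶠ d : ℕ in Filter.atTop, IsLargeDim c₁ c₂ c₄ d := by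
  have hlinear : ∀ᶠ d : ℕ in Filter.atTop, exp 1 ≤ c₁ * d :=
    (tendsto_natCast_atTop_atTop.const_mul_atTop hc₁).eventually_ge_atTop _
  have hpower : ∀ᶠ d : ℕ in Filter.atTop, 16 * c₂ ≤ (d : ℝ) ^ (c₄ / 2) :=
    ((tendsto_rpow_atTop (half_pos hc₄)).comp tendsto_natCast_atTop_atTop).eventually_ge_atTop _
  filter_upwards [Filter.eventually_ge_atTop 2, hlinear, hpower] with d h2 hl hp
  exact ⟨h2, hl, hp⟩

namespace IsLargeDim

lemma pos (hd : IsLargeDim c₁ c₂ c₄ d) : 0 < d := two_pos.trans_le hd.two_le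

lemma half_lt_log (hd : IsLargeDim c₁ c₂ c₄ d) : 1 / 2 < log d := by
  have h2 : log 2 ≤ log d := log_le_log two_pos (by exact_mod_cast hd.two_le)
  linarith [log_two_gt_d9]

lemma mul_maxNorm_sq_le (hd : IsLargeDim c₁ c₂ c₄ d) : n * maxNorm X ^ 2 ≤ rho X ^ 2 := by
  rw [rho_sq]
  have hℓ := hd.half_lt_log
  have hnM : 0 ≤ n * maxNorm X ^ 2 := by positivity
  nlinarith

end IsLargeDim

end LargeDimension

section PosteriorBounds

variable {w : Finset (Fin d) → ℝ} {h : ℕ → ℝ} {B : Set (Fin d → ℝ)} {b x : ℝ}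

lemma measurable_l0norm : Measurable fun θ : Fin d → ℝ => (l0norm θ : ℝ) := by
  have hsum : (fun θ : Fin d → ℝ => (l0norm θ : ℝ)) = fun θ => ∑ j, if θ j = 0 then 0 else 1 := by
    funext θ
    simp [l0norm, supp, Finset.card_filter]
  rw [hsum]
  exact Finset.measurable_sum _ fun j _ => Measurable.ite
    ((measurableSet_singleton 0).preimage (measurable_pi_apply j)) measurable_const
    measurable_const

lemma measurable_l2norm_sub : Measurable fun θ : Fin d → ℝ => l2norm (θ - θs) := by
  unfold l2norm
  fun_prop

lemma l0norm_le (θ : Fin d → ℝ) : l0norm θ ≤ d :=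
  (Finset.card_le_univ (supp θ)).trans_eq (Fintype.card_fin d)

lemma choose_le_exp (hd : 0 < d) (s : ℕ) : (d.choose s : ℝ) ≤ exp (s * log d) := by
  rw [exp_nat_mul, exp_log (Nat.cast_pos.2 hd)]
  exact_mod_cast Nat.choose_le_pow d s

lemma condPrior_eq_zero_of_card_lt {ρ : ℝ} (hρ : 0 < ρ) {δ : Finset (Fin d)}
    (hB : ∀ θ ∈ B, x ≤ l0norm θ) (hδ : δ.card < x) : condPrior ρ δ B = 0 := by
  refine measure_eq_zero_iff_ae_notMem.2 ?_
  filter_upwards [ae_supp_subset hρ] with θ hθ hmem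
  have hcard : (l0norm θ : ℝ) ≤ δ.card := Nat.cast_le.2 (Finset.card_le_card hθ)
  exact absurd (hB θ hmem) (not_le.2 (hcard.trans_lt hδ))

lemma IsSizePrior.posterior_le (hh : IsSizePrior d c₁ c₂ c₃ c₄ h)
    (hw : ∀ δ : Finset (Fin d), w δ = h δ.card / (d.choose δ.card : ℝ))
    (hd : IsLargeDim c₁ c₂ c₄ d) (hc₄ : 0 < c₄) (hρ : 0 < rho X) (hB : MeasurableSet B)
    (hBx : ∀ θ ∈ B, x ≤ l0norm θ)
    (hb : ∀ θ ∈ B, logRatio X (rho X) θs z θ ≤ b - 1 / 8 * rho X * l1norm (θ - θs))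
    {t : ℕ} (ht : t ≤ d) (hx : t ≤ x) :
    posterior X (rho X) w z B ≤ ENNReal.ofReal (2 * (h t * 8 ^ t / h (l0norm θs)) *
      exp (b + l0norm θs / 4 + l0norm θs * log d - c₄ / 2 * log d * (x - t))) := by
  have hwpos (δ : Finset (Fin d)) : 0 < w δ := by
    have hcard : δ.card ≤ d := (Finset.card_le_univ δ).trans_eq (Fintype.card_fin d)
    rw [hw]
    exact div_pos (hh.pos _ hcard) (Nat.cast_pos.2 (Nat.choose_pos hcard))
  refine (SparseLogit.posterior_le hρ hd.mul_maxNorm_sq_le (fun δ => (hwpos δ).le) (hwpos _)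
    (by norm_num) hB hb (D := Finset.univ.filter fun δ => x ≤ δ.card) fun δ hδ =>
      condPrior_eq_zero_of_card_lt hρ hBx (by simpa using hδ)).trans (ENNReal.ofReal_le_ofReal ?_)
  have htail := hh.sum_mul_eight_pow_le hd.pos hc₄ hd.mul_le_rpow ht hx
  have hs0 := hh.pos _ (l0norm_le θs)
  have ht0 := hh.pos t ht
  have hchoose : (0 : ℝ) < d.choose (l0norm θs) := Nat.cast_pos.2 (Nat.choose_pos (l0norm_le θs))
  rw [one_div, inv_inv, sum_filter_card_mul_pow (p := fun k => x ≤ k) hw, hw, ← l0norm]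
  calc exp (b + l0norm θs / 4) * (∑ k ∈ Finset.range (d + 1) with (x ≤ ((k : ℕ) : ℝ)), h k * 8 ^ k)
        / (h (l0norm θs) / d.choose (l0norm θs))
      ≤ exp (b + l0norm θs / 4) * (2 * (h t * 8 ^ t) * exp (-(c₄ / 2 * log d * (x - t))))
          / (h (l0norm θs) / d.choose (l0norm θs)) := by gcongr
    _ = 2 * (h t * 8 ^ t / h (l0norm θs)) * (exp (b + l0norm θs / 4) *
          d.choose (l0norm θs) * exp (-(c₄ / 2 * log d * (x - t)))) := by field_simp
    _ ≤ 2 * (h t * 8 ^ t / h (l0norm θs)) * (exp (b + l0norm θs / 4) *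
          exp (l0norm θs * log d) * exp (-(c₄ / 2 * log d * (x - t)))) := by
        gcongr
        exact choose_le_exp hd.pos _
    _ = _ := by rw [← exp_add, ← exp_add, ← sub_eq_add_neg]

lemma ofReal_two_mul_exp_le (hd : 0 < d) {y : ℝ} (hy : y ≤ -log d) :
    ENNReal.ofReal (2 * exp y) ≤ 2 / (d : ℝ≥0∞) := by
  have hd' : (0 : ℝ) < d := Nat.cast_pos.2 hd
  rw [← ENNReal.ofReal_natCast d, ← ENNReal.ofReal_ofNat 2, ← ENNReal.ofReal_div_of_pos hd']
  refine ENNReal.ofReal_le_ofReal ?_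
  have hinv : exp y ≤ (d : ℝ)⁻¹ := by
    rwa [← log_le_log_iff (exp_pos y) (by positivity), log_exp, log_inv]
  rw [div_eq_mul_inv]
  exact mul_le_mul_of_nonneg_left hinv zero_le_two

lemma ScoreBounded.posterior_large_le (hz : ScoreBounded X (rho X) θs z)
    (hd : IsLargeDim c₁ c₂ c₄ d) (hc₁ : 0 < c₁) (hc₂ : 0 < c₂) (hc₄ : 0 < c₄)
    (hw : SparsePrior d c₁ c₂ c₃ c₄ w) (hk : 0 < kappaMin c₄ X θs)
    (hsize : SampleSizeBound X θs (kappaMin c₄ X θs).toReal) :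
    posterior X (rho X) w z {θ | zeta c₄ X θs ≤ l0norm θ} ≤ 2 / (d : ℝ≥0∞) := by
  obtain ⟨h, hh, hwh⟩ := hw.exists_isSizePrior hd.pos hc₁ hc₂
  have hℓ : 0 < log d := one_half_pos.trans hd.half_lt_log
  have hρ : 0 < rho X := rho_pos (maxNorm_pos_of_kappaMin_pos hk) hℓ
  have hζ := l0norm_lt_zeta hc₄ (kappa_pos_of_kappaMin_pos hk).le
  have hb (θ : Fin d → ℝ) : logRatio X (rho X) θs z θ ≤
      64 * maxNorm X ^ 2 / (kappa X θs).toReal * l0norm θs * log d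
        - 1 / 8 * rho X * l1norm (θ - θs) := by
    linarith [hz.logRatio_le_sub_l1norm_of_kappaMin_pos hk hsize θ,
      mul_nonneg hρ.le (l1norm_nonneg (θ - θs))]
  refine (hh.posterior_le hwh hd hc₄ hρ (measurableSet_le measurable_const measurable_l0norm)
    (fun θ hθ => hθ) (fun θ _ => hb θ) (l0norm_le θs) hζ.le).trans ?_
  have hs0 := (hh.pos _ (l0norm_le θs)).ne'
  have hlog : log 8 + 1 / 4 ≤ log (4 * exp 1) := by
    rw [log_four_mul_exp_one, show (8 : ℝ) = 4 * 2 by norm_num,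
      log_mul (by norm_num) (by norm_num)]
    linarith [log_two_lt_d9]
  have h8 : (8 : ℝ) ^ l0norm θs = exp (l0norm θs * log 8) := by
    rw [exp_nat_mul, exp_log (by norm_num)]
  rw [mul_div_assoc, mul_div_cancel₀ _ hs0, h8, mul_assoc, ← exp_add]
  refine ofReal_two_mul_exp_le hd.pos ?_
  linarith [log_add_le_mul_zeta_sub (X := X) (θs := θs) hc₄ hℓ,
    mul_le_mul_of_nonneg_right hlog (Nat.cast_nonneg (α := ℝ) (l0norm θs))]

lemma posterior_le_of_logRatio_le (hd : IsLargeDim c₁ c₂ c₄ d) (hc₁ : 0 < c₁) (hc₂ : 0 < c₂)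
    (hc₄ : 0 < c₄) (hc₃ : 0 < c₃) (hw : SparsePrior d c₁ c₂ c₃ c₄ w) (hρ : 0 < rho X)
    (hB : MeasurableSet B)
    (hb : ∀ θ ∈ B, logRatio X (rho X) θs z θ ≤
      -((2 + c₃) * (1 + l0norm θs) * log d) - 1 / 8 * rho X * l1norm (θ - θs)) :
    posterior X (rho X) w z B ≤ 2 / (d : ℝ≥0∞) := by
  obtain ⟨h, hh, hwh⟩ := hw.exists_isSizePrior hd.pos hc₁ hc₂
  have hd' : (0 : ℝ) < d := Nat.cast_pos.2 hd.pos
  refine (hh.posterior_le hwh hd hc₄ hρ hB (fun θ _ => Nat.cast_nonneg _) hb d.zero_le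
    Nat.cast_zero.le).trans ?_
  have hodds : h 0 * 8 ^ 0 / h (l0norm θs) ≤ exp (l0norm θs * (c₃ * log d + log d - 1)) := by
    have hs0 := hh.pos _ (l0norm_le θs)
    have hbase : (d : ℝ) ^ c₃ / c₁ ≤ exp (c₃ * log d + log d - 1) := by
      rw [exp_sub, exp_add, exp_log hd', mul_comm c₃, ← rpow_def_of_pos hd',
        div_le_div_iff₀ hc₁ (exp_pos 1), mul_assoc, mul_comm _ c₁]
      gcongr
      exact hd.exp_one_le
    rw [pow_zero, mul_one, div_le_iff₀ hs0, exp_nat_mul]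
    refine (hh.zero_le_pow_mul hd.pos hc₁ (l0norm_le θs)).trans ?_
    gcongr
  refine le_trans (ENNReal.ofReal_le_ofReal ?_) (ofReal_two_mul_exp_le hd.pos le_rfl)
  refine (mul_le_mul_of_nonneg_right (mul_le_mul_of_nonneg_left hodds zero_le_two)
    (exp_nonneg _)).trans ?_
  rw [mul_assoc, ← exp_add, Nat.cast_zero, sub_zero, mul_zero, sub_zero]
  gcongr
  have hℓ : 0 < log d := one_half_pos.trans hd.half_lt_log
  have hc₃ℓ := mul_pos hc₃ hℓ
  linarith [Nat.cast_nonneg (α := ℝ) (l0norm θs)]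

lemma ScoreBounded.posterior_far_le (hz : ScoreBounded X (rho X) θs z)
    (hd : IsLargeDim c₁ c₂ c₄ d) (hc₁ : 0 < c₁) (hc₂ : 0 < c₂) (hc₄ : 0 < c₄) (hc₃ : 0 < c₃)
    (hw : SparsePrior d c₁ c₂ c₃ c₄ w) (hk : 0 < kappaMin c₄ X θs)
    (hsize : SampleSizeBound X θs (kappaMin c₄ X θs).toReal) :
    posterior X (rho X) w z {θ | 11 * (5 + (2 + c₃)) * maxNorm X /
      kappaSparse X θs (sBar c₄ X θs) * √(sBar c₄ X θs * log d / n) < l2norm (θ - θs)} ≤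
      2 / (d : ℝ≥0∞) + 2 / (d : ℝ≥0∞) := by
  set F := {θ | 11 * (5 + (2 + c₃)) * maxNorm X / kappaSparse X θs (sBar c₄ X θs) *
    √(sBar c₄ X θs * log d / n) < l2norm (θ - θs)}
  have hℓ : 0 < log d := one_half_pos.trans hd.half_lt_log
  have hκ₁ := kappa_pos_of_kappaMin_pos hk
  have hcover : F ⊆ {θ | zeta c₄ X θs ≤ l0norm θ} ∪ {θ ∈ F | l0norm θ < zeta c₄ X θs} :=
    fun θ hθ => (le_or_gt (zeta c₄ X θs) (l0norm θ)).imp id fun h => ⟨hθ, h⟩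
  have hfar : posterior X (rho X) w z {θ ∈ F | l0norm θ < zeta c₄ X θs} ≤ 2 / (d : ℝ≥0∞) := by
    refine posterior_le_of_logRatio_le (θs := θs) hd hc₁ hc₂ hc₄ hc₃ hw
      (rho_pos (maxNorm_pos_of_kappaMin_pos hk) hℓ)
      ((measurableSet_lt measurable_const measurable_l2norm_sub).inter
        (measurableSet_lt measurable_l0norm measurable_const)) fun θ hθ => ?_
    exact hz.logRatio_le_of_far (by linarith) hℓ
      (isCompatibilityConst_toReal hk (min_le_left _ _)) (toReal_kappaMin_pos hk)
      (toReal_kappaMin_le_kappaSparse hk) hsize (l0norm_le_sBar hc₄ hκ₁.le)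
      (one_le_sBar hc₄ hκ₁.le) (l0norm_sub_le_sBar hθ.2) hθ.1
  exact (measure_mono hcover).trans ((measure_union_le _ _).trans
    (add_le_add (hz.posterior_large_le hd hc₁ hc₂ hc₄ hw hk hsize) hfar))

end PosteriorBounds

end SparseLogit

theorem theorem2 :
    ∃ A : ℝ, 0 < A ∧
    ∀ c₁ c₂ c₃ c₄ : ℝ, 0 < c₁ → 0 < c₂ → 0 < c₄ → c₄ ≤ c₃ →
    ∃ M₀ : ℝ, 2 < M₀ ∧ ∃ d₀ : ℕ, ∀ d : ℕ, d₀ ≤ d →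
    ∀ (n : ℕ) (X : Matrix (Fin n) (Fin d) ℝ) (θs : Fin d → ℝ) (w : Finset (Fin d) → ℝ)
      (Ω : Type*) [MeasurableSpace Ω] (P : Measure Ω) [IsProbabilityMeasure P]
      (Z : Fin n → Ω → ℝ),
      SparseLogit.LogisticModel P X θs Z →
      SparseLogit.SparsePrior d c₁ c₂ c₃ c₄ w →
      0 < SparseLogit.kappaMin c₄ X θs →
      A * SparseLogit.maxNorm X ^ 4 *
          ((SparseLogit.l0norm θs : ℝ) / (SparseLogit.kappaMin c₄ X θs).toReal) ^ 2 *
          Real.log d ≤ (n : ℝ) →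
      (∫⁻ ω, SparseLogit.posterior X (SparseLogit.rho X) w (fun i => Z i ω)
          {θ | SparseLogit.zeta c₄ X θs ≤ (SparseLogit.l0norm θ : ℝ)} ∂P ≤ 4 / (d : ℝ≥0∞)) ∧
      (∫⁻ ω, SparseLogit.posterior X (SparseLogit.rho X) w (fun i => Z i ω)
          {θ | M₀ * SparseLogit.maxNorm X /
                SparseLogit.kappaSparse X θs (SparseLogit.sBar c₄ X θs) *
                √((SparseLogit.sBar c₄ X θs : ℝ) * Real.log d / n) <
              SparseLogit.l2norm (θ - θs)} ∂P ≤ 12 / (d : ℝ≥0∞)) := by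
  refine ⟨112 ^ 2, by norm_num, fun c₁ c₂ c₃ c₄ hc₁ hc₂ hc₄ hc₃₄ => ?_⟩
  have hc₃ : 0 < c₃ := hc₄.trans_le hc₃₄
  obtain ⟨d₀, hd₀⟩ := Filter.eventually_atTop.1 (SparseLogit.eventually_isLargeDim hc₁ hc₄)
  refine ⟨11 * (5 + (2 + c₃)), by linarith, d₀, ?_⟩
  intro d hdd n X θs w Ω _ P _ Z hZ hw hk hsize
  have hd : SparseLogit.IsLargeDim c₁ c₂ c₄ d := hd₀ d hdd
  have hM : 0 < SparseLogit.maxNorm X := SparseLogit.maxNorm_pos_of_kappaMin_pos hk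
  constructor
  · refine (hZ.lintegral_posterior_le hM hd.pos fun z hz =>
      hz.posterior_large_le hd hc₁ hc₂ hc₄ hw hk hsize).trans ?_
    rw [← ENNReal.add_div]
    exact ENNReal.div_le_div_right (by norm_num) _
  · refine (hZ.lintegral_posterior_le hM hd.pos fun z hz =>
      hz.posterior_far_le hd hc₁ hc₂ hc₄ hc₃ hw hk hsize).trans ?_
    rw [← ENNReal.add_div, ← ENNReal.add_div]
    exact ENNReal.div_le_div_right (by norm_num) _
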